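/- **Lemma (Positively Generated Hocolim).** Let $R$ be a commutative ring containing $\mathbb{Q}$. A *cdg-algebra* over $R$ is a $\mathbb{Z}$-graded, graded-commutative, unital differential graded $R$-algebra. Use either the homological convention (differentials of degree $-1$) with $R$ arbitrary, or the cohomological convention (differentials of degree $+1$) with $R$ a field. An *augmentation* of $A$ is a map of cdg-algebras from $A$ to $R$, where $R$ lies in degree $0$ and has zero differential. A cdg-algebra is *$k$-positively generated* ($k\ge 0$) if it is generated as a unital algebra by homogeneous elements of degree larger than $k$. It is *Sullivan* if it is isomorphic, as a graded algebra, to the free graded-commutative algebra $SV$ on a free graded $R$-module $V=\bigoplus_{i\in I}M_i$, where $I$ is a well-ordered set, each $M_i$ is a free graded $R$-module, and $dM_i\subset S\big(\bigoplus_{j<i}M_j\big)$ for all $i\in I$. Let weak equivalences be quasi-isomorphisms, let fibrations be surjective maps, and let cofibrations be the maps with the left lifting property against all surjective quasi-isomorphisms. A *homotopy colimit* of a sequence $A_1\to A_2\to\cdots$ is a colimit of a cofibrant replacement, that is, of a sequence $E_1\to E_2\to\cdots$ in which $R\to E_1$ and every $E_i\to E_{i+1}$ are cofibrations, together with a map of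 sequences $E\to A$ such that every $E_i\to A_i$ is a quasi-isomorphism. Two cdg-algebras are *quasi-isomorphic* if they are connected by a finite zigzag of quasi-isomorphisms. Let $k\ge 0$ be an integer and let $A_1\to A_2\to\cdots$ be a sequence of maps of $k$-positively generated Sullivan cdg-algebras over $R$, each of which admits an augmentation. Then the sequence has a homotopy colimit, and every homotopy colimit of it is quasi-isomorphic to a $k$-positively generated Sullivan cdg-algebra. -/

import Mathlib

open CategoryTheory

universe u

/-- A `ℤ`-graded, graded-commutative differential graded algebra over `R`, whose differential
has degree `δ`. The value `δ = -1` is the homological grading convention and `δ = 1` is the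
cohomological one. -/
structure CDGA (R : Type u) [CommRing R] (δ : ℤ) where
  carrier : Type u
  [ring : Ring carrier]
  [algebra : Algebra R carrier]
  /-- the homogeneous elements of a given degree -/
  grading : ℤ → Submodule R carrier
  isInternal : DirectSum.IsInternal grading
  one_mem : (1 : carrier) ∈ grading 0
  mul_mem : ∀ {m n : ℤ} {a b : carrier}, a ∈ grading m → b ∈ grading n →
    a * b ∈ grading (m + n)
  graded_comm : ∀ {m n : ℤ} {a b : carrier}, a ∈ grading m → b ∈ grading n →
    a * b = (m * n).negOnePow • (b * a)
  d : carrier →ₗ[R] carrier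
  d_mem : ∀ {n : ℤ} {a : carrier}, a ∈ grading n → d a ∈ grading (n + δ)
  d_d : ∀ a, d (d a) = 0
  leibniz : ∀ {m : ℤ} {a : carrier} (b : carrier), a ∈ grading m →
    d (a * b) = d a * b + m.negOnePow • (a * d b)

namespace CDGA

attribute [instance] CDGA.ring CDGA.algebra

variable {R : Type u} [CommRing R] {δ : ℤ}

instance : CoeSort (CDGA R δ) (Type u) := ⟨CDGA.carrier⟩

/-- Maps of cdg-algebras: unital algebra maps that preserve the degree and commute with the
differentials. -/
@[ext]
structure Hom (A B : CDGA R δ) where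
  toAlgHom : A →ₐ[R] B
  map_mem : ∀ {n : ℤ} {a : A}, a ∈ A.grading n → toAlgHom a ∈ B.grading n
  map_d : ∀ a, toAlgHom (A.d a) = B.d (toAlgHom a)

instance : Category (CDGA R δ) where
  Hom := Hom
  id A := ⟨AlgHom.id R A, fun h => h, fun _ => rfl⟩
  comp f g := ⟨g.toAlgHom.comp f.toAlgHom, fun h => g.map_mem (f.map_mem h), fun a => by
    simp [f.map_d, g.map_d]⟩

/-! ### Homology and quasi-isomorphisms -/

/-- The homology `ker d / im d`. -/
abbrev Homology (A : CDGA R δ) : Type u :=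
  LinearMap.ker A.d ⧸ (LinearMap.range A.d).comap (LinearMap.ker A.d).subtype

/-- The map on cycles induced by a map of cdg-algebras. -/
def cyclesMap {A B : CDGA R δ} (f : A ⟶ B) : LinearMap.ker A.d →ₗ[R] LinearMap.ker B.d :=
  f.toAlgHom.toLinearMap.restrict fun a ha => by
    have h : A.d a = 0 := ha
    change B.d (f.toAlgHom a) = 0
    rw [← f.map_d, h, map_zero]

/-- The map on homology induced by a map of cdg-algebras. -/
def homologyMap {A B : CDGA R δ} (f : A ⟶ B) : A.Homology →ₗ[R] B.Homology :=
  Submodule.mapQ _ _ (cyclesMap f) <| by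
    rintro ⟨a, ha⟩ ⟨b, hb⟩
    exact ⟨f.toAlgHom b, (f.map_d b).symm.trans (congrArg f.toAlgHom hb)⟩

/-- A quasi-isomorphism (weak equivalence) of cdg-algebras. -/
def IsQuasiIso {A B : CDGA R δ} (f : A ⟶ B) : Prop := Function.Bijective (homologyMap f)

/-- Two cdg-algebras are quasi-isomorphic if they are joined by a finite zigzag of
quasi-isomorphisms. -/
def QuasiIsomorphic (A B : CDGA R δ) : Prop :=
  Relation.EqvGen (fun X Y : CDGA R δ => ∃ f : X ⟶ Y, IsQuasiIso f) A B

/-! ### The coefficient ring and augmentations -/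

variable (R δ) in
/-- The coefficient ring `R`, concentrated in degree `0`, with zero differential. -/
def base : CDGA R δ where
  carrier := R
  grading n := if n = 0 then ⊤ else ⊥
  isInternal := by
    rw [DirectSum.isInternal_submodule_iff_iSupIndep_and_iSup_eq_top]
    constructor
    · intro i
      by_cases hi : i = 0
      · have h : (⨆ (j : ℤ) (_ : j ≠ i), (if j = 0 then ⊤ else ⊥ : Submodule R R)) = ⊥ := by
          refine iSup₂_eq_bot.2 fun j hj => ?_
          rw [if_neg (fun h => hj (h.trans hi.symm))]
        exact Disjoint.mono_right (le_of_eq h) disjoint_bot_right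
      · simp [hi]
    · refine top_le_iff.1 (le_trans ?_ (le_iSup _ (0 : ℤ)))
      simp
  one_mem := by simp
  mul_mem := by
    intro m n a b ha hb
    by_cases hm : m = 0 <;> by_cases hn : n = 0 <;> simp_all
  graded_comm := by
    intro m n a b ha hb
    by_cases hm : m = 0 <;> by_cases hn : n = 0 <;> simp_all [mul_comm]
  d := 0
  d_mem := by simp
  d_d := by simp
  leibniz := by simp

/-- The unit `R → A` of a cdg-algebra. -/
def unit (A : CDGA R δ) : base R δ ⟶ A where
  toAlgHom := Algebra.ofId R A
  map_mem := by
    have key : ∀ (n : ℤ) (a : R), a ∈ (if n = 0 then ⊤ else ⊥ : Submodule R R) →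
        algebraMap R A a ∈ A.grading n := by
      intro n a ha
      by_cases hn : n = 0
      · subst hn
        rw [Algebra.algebraMap_eq_smul_one]
        exact Submodule.smul_mem _ _ A.one_mem
      · rw [if_neg hn, Submodule.mem_bot] at ha
        rw [ha, map_zero]
        exact Submodule.zero_mem _
    exact fun {n a} ha => key n a ha
  map_d := by
    have h1 : A.d 1 = 0 := by
      have h := A.leibniz (1 : A) A.one_mem
      simpa using h
    have key : ∀ a : R, algebraMap R A 0 = A.d (algebraMap R A a) := by
      intro a
      rw [map_zero, Algebra.algebraMap_eq_smul_one, map_smul, h1, smul_zero]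
    exact key

/-- An augmentation of `A` is a map of cdg-algebras from `A` to the coefficient ring. -/
abbrev Augmentation (A : CDGA R δ) : Type u := A ⟶ base R δ

/-- `A` is `k`-positively generated: it is generated, as a unital algebra, by homogeneous elements
of degree larger than `k`. -/
def IsPosGenerated (k : ℕ) (A : CDGA R δ) : Prop :=
  Algebra.adjoin R {a : A | ∃ n : ℤ, (k : ℤ) < n ∧ a ∈ A.grading n} = ⊤

/-! ### Free graded-commutative algebras and Sullivan algebras -/

/-- The relations `x y = (-1)^{|x||y|} y x` between generators `x, y` of degrees `|x|, |y|`. -/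
inductive FreeGCRel (R : Type u) [CommRing R] {X : Type u} (deg : X → ℤ) :
    FreeAlgebra R X → FreeAlgebra R X → Prop
  | swap (x y : X) : FreeGCRel R deg (FreeAlgebra.ι R x * FreeAlgebra.ι R y)
      ((deg x * deg y).negOnePow • (FreeAlgebra.ι R y * FreeAlgebra.ι R x))

/-- The free graded-commutative algebra `SV` on the free graded module `V` with homogeneous
basis `X`, over a ring `R` in which `2` is invertible. -/
abbrev FreeGC (R : Type u) [CommRing R] {X : Type u} (deg : X → ℤ) : Type u :=
  RingQuot (FreeGCRel R deg)

/-- The basis vector of `V ⊆ SV` that belongs to `x`. -/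
def FreeGC.gen (R : Type u) [CommRing R] {X : Type u} (deg : X → ℤ) (x : X) : FreeGC R deg :=
  RingQuot.mkAlgHom R (FreeGCRel R deg) (FreeAlgebra.ι R x)

/-- `A` is Sullivan: there is a graded algebra isomorphism `φ : SV ≃ A` where `V = ⨁_{i ∈ I} M_i`
for a well-ordered set `I` and `d M_i ⊆ S(⨁_{j < i} M_j)`. Here `X` is a homogeneous basis of `V`
and `M_i` is the free module with basis `{x | level x = i}`. -/
def IsSullivan (A : CDGA R δ) : Prop :=
  ∃ (X I : Type u) (_ : LinearOrder I) (_ : WellFoundedLT I) (deg : X → ℤ) (level : X → I)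
    (φ : FreeGC R deg ≃ₐ[R] A),
    (∀ x, φ (FreeGC.gen R deg x) ∈ A.grading (deg x)) ∧
    ∀ x, A.d (φ (FreeGC.gen R deg x)) ∈
      Algebra.adjoin R ((fun y => φ (FreeGC.gen R deg y)) '' {y | level y < level x})

/-! ### Cofibrations and sequential homotopy colimits -/

variable (R δ) in
/-- Acyclic fibrations: surjective quasi-isomorphisms. -/
def acyclicFibrations : MorphismProperty (CDGA R δ) :=
  fun _ _ p => Function.Surjective p.toAlgHom ∧ IsQuasiIso p

variable (R δ) in
/-- Cofibrations: maps with the left lifting property against the acyclic fibrations. -/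
def cofibrations : MorphismProperty (CDGA R δ) := (acyclicFibrations R δ).llp

/-- A sequence `E 0 ⟶ E 1 ⟶ ⋯` is cofibrant in the Reedy model structure if `E 0` is cofibrant
(the map from the initial object `R` is a cofibration) and each map of the sequence is a
cofibration. -/
def IsCofibrantSequence (E : ℕ ⥤ CDGA R δ) : Prop :=
  cofibrations R δ (unit (E.obj 0)) ∧
    ∀ i : ℕ, cofibrations R δ (E.map (homOfLE (Nat.le_succ i)))

/-- `H` is a homotopy colimit of the sequence `A`: it is a colimit of some cofibrant replacement
`E ⟶ A`. -/
def IsHocolim (A : ℕ ⥤ CDGA R δ) (H : CDGA R δ) : Prop :=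
  ∃ (E : ℕ ⥤ CDGA R δ) (w : E ⟶ A), IsCofibrantSequence E ∧ (∀ i, IsQuasiIso (w.app i)) ∧
    ∃ c : Limits.Cocone E, Nonempty (Limits.IsColimit c) ∧ c.pt = H

end CDGA

/-!
Every map `f : B ⟶ A` of cdg-algebras can be factored through relative cell complexes. A cell of
degree `n` over `f` is a cycle `z` of `B` of degree `n + δ` together with a primitive `a` of its
image in `A`; attaching it means to adjoin to `B` a free generator `x` of degree `n` with
`d x = z`, which is sent to `a`. Attaching cells is a cofibration
(`CDGA.adjoinCells.cofibrations_inclHom`), and repeating it infinitely often gives a factorization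
`B ⟶ M ⟶ A` in which `M ⟶ A` induces an isomorphism on homology in the range of degrees in which
enough cells have been attached (`CDGA.CellSystem.fillsCells_modelMap`).

With all cells, this factors a map into a cofibration and a quasi-isomorphism. Applied
successively to the unit of the first term and to the maps of the sequence, it gives a cofibrant
replacement of any sequence, whose colimit is a homotopy colimit (`CDGA.exists_isHocolim`).

For the second claim only the homology of the homotopy colimit `H` matters. An augmented algebra
that is generated in degrees larger than `k` has the homology of `R` in degrees up to `k`
(`CDGA.IsPosGenerated.isHomologyTrivialTo`), and so has `H`, since homology commutes with
sequential colimits. The model `M` of `R ⟶ H` that is built from cells of degree larger than `k`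
only is a Sullivan algebra (`CDGA.CellSystem.isSullivan_model`), the level of a generator being
the stage in which it is attached. It remains to see that `M ⟶ H` is a quasi-isomorphism
(`CDGA.CellSystem.isQuasiIso_modelMap`). The cells at hand make it surjective on homology in
degrees larger than `k`, and injective in degrees larger than `k + δ`. In the remaining degrees,
the homology of `M` is that of `R`, except for injectivity in degree `k + 1` in the case `δ = 1`.
There `R` is a field, and the cells can be chosen in each stage to be a basis of the relative
homology. Then no new cycles appear in degree `k + 1` beyond those that represent the homology of
`H` (`CDGA.CellSystem.eq_zero_of_stage`).

On the technical side, the grading of an algebra with adjoined generators is the grading by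
monomials, and the sum of its homogeneous parts is direct because of the coaction `a ↦ a T ^ n`
into Laurent polynomials; the differential is the upper right entry of an algebra map into
`2 × 2`-matrices, so that the Leibniz rule needs no separate argument.
-/

/-! ### Gradings -/

theorem DirectSum.isInternal_of_projections {R : Type*} {A : Type*} [CommRing R] [AddCommGroup A]
    [Module R A] (G : ℤ → Submodule R A) (π : ℤ → A →+ A)
    (h_same : ∀ n, ∀ a ∈ G n, π n a = a) (h_ne : ∀ m n, m ≠ n → ∀ a ∈ G m, π n a = 0)
    (hG : ⨆ n, G n = ⊤) : DirectSum.IsInternal G := by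
  have key : ∀ (x : DirectSum ℤ fun n => G n) (n : ℤ),
      π n (DirectSum.coeAddMonoidHom G x) = x n := by
    intro x n
    induction x using DirectSum.induction_on with
    | zero => simp
    | of m a =>
      rw [DirectSum.coeAddMonoidHom_of]
      by_cases h : m = n
      · subst h
        rw [h_same _ _ a.2, DirectSum.of_eq_same]
      · rw [h_ne _ _ h _ a.2, DirectSum.of_eq_of_ne _ _ _ (Ne.symm h)]
        rfl
    | add x y hx hy => rw [map_add, map_add, hx, hy]; rfl
  refine ⟨?_, ?_⟩
  · rw [injective_iff_map_eq_zero]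
    intro x hx
    ext n
    rw [← key x n, hx, map_zero]
    rfl
  · intro a
    have ha : a ∈ ⨆ n, G n := hG ▸ Submodule.mem_top
    induction ha using Submodule.iSup_induction' with
    | mem n a ha => exact ⟨DirectSum.of (fun n => G n) n ⟨a, ha⟩, by simp⟩
    | zero => exact ⟨0, map_zero _⟩
    | add a b _ _ ha hb =>
      obtain ⟨x, rfl⟩ := ha
      obtain ⟨y, rfl⟩ := hb
      exact ⟨x + y, map_add _ _ _⟩

namespace CDGA

variable {R : Type u} [CommRing R] {δ : ℤ}

instance (A : CDGA R δ) : SetLike.GradedMonoid A.grading where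
  one_mem := A.one_mem
  mul_mem _ _ _ _ := A.mul_mem

noncomputable instance (A : CDGA R δ) : GradedAlgebra A.grading := A.isInternal.gradedAlgebra

/-- The homogeneous component of degree `n` of an element. -/
noncomputable def proj (A : CDGA R δ) (n : ℤ) : A →ₗ[R] A := GradedAlgebra.proj A.grading n

section proj

variable (A : CDGA R δ)

theorem proj_mem (n : ℤ) (a : A) : A.proj n a ∈ A.grading n :=
  (DirectSum.decompose A.grading a n).2

variable {A}

theorem proj_same {n : ℤ} {a : A} (ha : a ∈ A.grading n) : A.proj n a = a :=
  DirectSum.decompose_of_mem_same _ ha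

theorem proj_ne {m n : ℤ} {a : A} (ha : a ∈ A.grading m) (h : m ≠ n) : A.proj n a = 0 :=
  DirectSum.decompose_of_mem_ne _ ha h

/-- Every element is the sum of its homogeneous components. -/
theorem exists_finset_sum_proj (a : A) : ∃ s : Finset ℤ, a = ∑ n ∈ s, A.proj n a := by
  classical
  exact ⟨_, (DirectSum.sum_support_decompose A.grading a).symm⟩

/-- Induction on homogeneous elements. -/
theorem homogeneous_induction {p : A → Prop} (h : ∀ n, ∀ a ∈ A.grading n, p a)
    (hadd : ∀ a b, p a → p b → p (a + b)) (a : A) : p a := by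
  obtain ⟨s, hs⟩ := exists_finset_sum_proj a
  rw [hs]
  exact Finset.sum_induction _ p hadd (h 0 _ (A.grading 0).zero_mem)
    fun n _ => h n _ (A.proj_mem n a)

theorem d_proj (n : ℤ) (a : A) : A.d (A.proj n a) = A.proj (n + δ) (A.d a) := by
  induction a using homogeneous_induction with
  | h m a ha =>
    by_cases hmn : m = n
    · subst hmn
      rw [proj_same ha, proj_same (A.d_mem ha)]
    · rw [proj_ne ha hmn, proj_ne (A.d_mem ha) (by omega), map_zero]
  | hadd a b ha hb => simp only [map_add, ha, hb]

theorem map_proj {B : CDGA R δ} (f : A →ₗ[R] B)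
    (hf : ∀ n, ∀ a ∈ A.grading n, f a ∈ B.grading n) (n : ℤ) (a : A) :
    f (A.proj n a) = B.proj n (f a) := by
  induction a using homogeneous_induction with
  | h m a ha =>
    by_cases hmn : m = n
    · subst hmn
      rw [proj_same ha, proj_same (hf _ _ ha)]
    · rw [proj_ne ha hmn, proj_ne (hf _ _ ha) hmn, map_zero]
  | hadd a b ha hb => simp only [map_add, ha, hb]

theorem d_one : A.d 1 = 0 := by simpa using A.leibniz (1 : A) A.one_mem

theorem d_algebraMap (r : R) : A.d (algebraMap R A r) = 0 := by
  rw [Algebra.algebraMap_eq_smul_one, map_smul, d_one, smul_zero]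

theorem algebraMap_mem (r : R) : algebraMap R A r ∈ A.grading 0 := by
  rw [Algebra.algebraMap_eq_smul_one]
  exact Submodule.smul_mem _ _ A.one_mem

/-- An algebra map out of a graded algebra, given by linear maps on the homogeneous parts. -/
noncomputable def gradedLift {C : Type*} [Ring C] [Algebra R C] (f : ℤ → A →ₗ[R] C)
    (h_one : f 0 1 = 1)
    (h_mul : ∀ m n, ∀ a ∈ A.grading m, ∀ b ∈ A.grading n, f (m + n) (a * b) = f m a * f n b) :
    A →ₐ[R] C :=
  (DirectSum.toAlgebra R (fun n => A.grading n) (fun n => (f n).comp (A.grading n).subtype)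
    h_one (fun {m n} a b => h_mul m n a a.2 b b.2)).comp
    (DirectSum.decomposeAlgEquiv A.grading).toAlgHom

theorem gradedLift_of_mem {C : Type*} [Ring C] [Algebra R C] (f : ℤ → A →ₗ[R] C)
    (h_one : f 0 1 = 1)
    (h_mul : ∀ m n, ∀ a ∈ A.grading m, ∀ b ∈ A.grading n, f (m + n) (a * b) = f m a * f n b)
    {n : ℤ} {a : A} (ha : a ∈ A.grading n) : gradedLift f h_one h_mul a = f n a := by
  have : DirectSum.decompose A.grading a = DirectSum.of (fun n => A.grading n) n ⟨a, ha⟩ :=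
    DirectSum.decompose_of_mem _ ha
  refine (congrArg (DirectSum.toAlgebra R (fun n => A.grading n)
    (fun n => (f n).comp (A.grading n).subtype) h_one
    (fun {m n} a b => h_mul m n a a.2 b b.2)) this).trans ?_
  exact DirectSum.toAddMonoid_of
    (fun n => ((f n).comp (A.grading n).subtype).toAddMonoidHom) n ⟨a, ha⟩

end proj

theorem negOnePow_smul_mem {M : Type*} [AddCommGroup M] [Module R M] (p : Submodule R M) (n : ℤ)
    {a : M} (ha : a ∈ p) : n.negOnePow • a ∈ p := by
  rcases Int.units_eq_one_or n.negOnePow with h | h <;> rw [h] <;> simpa [Units.smul_def] using ha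

theorem map_negOnePow_smul {M N F : Type*} [AddCommGroup M] [AddCommGroup N] [FunLike F M N]
    [AddMonoidHomClass F M N] (f : F) (n : ℤ) (a : M) :
    f (n.negOnePow • a) = n.negOnePow • f a := by
  rcases Int.units_eq_one_or n.negOnePow with h | h <;> rw [h] <;> simp [Units.smul_def]

/-- The sign involution, which is `(-1) ^ n` in degree `n`. -/
noncomputable def sign (A : CDGA R δ) : A →ₐ[R] A :=
  gradedLift (fun n => ((n.negOnePow : ℤ) • LinearMap.id : A →ₗ[R] A)) (by simp)
    (fun m n a _ b _ => by
      simp only [LinearMap.smul_apply, LinearMap.id_apply, Int.negOnePow_add, Units.val_mul]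
      rw [smul_mul_smul_comm])

theorem sign_of_mem {A : CDGA R δ} {n : ℤ} {a : A} (ha : a ∈ A.grading n) :
    A.sign a = n.negOnePow • a :=
  (gradedLift_of_mem _ _ _ ha).trans (by
    simp only [LinearMap.smul_apply, LinearMap.id_apply, Units.smul_def])

/-- The Leibniz rule without homogeneity assumption. -/
theorem d_mul (A : CDGA R δ) (a b : A) : A.d (a * b) = A.d a * b + A.sign a * A.d b := by
  induction a using homogeneous_induction with
  | h m a ha => rw [A.leibniz b ha, sign_of_mem ha, smul_mul_assoc]
  | hadd a a' ha ha' => simp only [add_mul, map_add, ha, ha']; abel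

end CDGA

namespace CDGA

variable {R : Type u} [CommRing R] {δ : ℤ}

/-! ### Quasi-isomorphisms and lifting -/

@[simp]
theorem comp_apply {A B C : CDGA R δ} (f : A ⟶ B) (g : B ⟶ C) (a : A) :
    (f ≫ g).toAlgHom a = g.toAlgHom (f.toAlgHom a) := rfl

@[simp]
theorem id_apply {A : CDGA R δ} (a : A) : Hom.toAlgHom (𝟙 A) a = a := rfl

theorem hom_ext {A B : CDGA R δ} {f g : A ⟶ B} (h : ∀ a, f.toAlgHom a = g.toAlgHom a) : f = g :=
  Hom.ext (AlgHom.ext h)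

theorem hom_proj {A B : CDGA R δ} (f : A ⟶ B) (n : ℤ) (a : A) :
    f.toAlgHom (A.proj n a) = B.proj n (f.toAlgHom a) :=
  map_proj f.toAlgHom.toLinearMap (fun _ _ h => f.map_mem h) n a

theorem homologyMap_mk {A B : CDGA R δ} (f : A ⟶ B) (z : LinearMap.ker A.d) :
    homologyMap f (Submodule.Quotient.mk z) = Submodule.Quotient.mk (cyclesMap f z) := rfl

theorem homology_mk_eq_zero {A : CDGA R δ} (z : LinearMap.ker A.d) :
    (Submodule.Quotient.mk z : A.Homology) = 0 ↔ ∃ a, A.d a = z := by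
  rw [Submodule.Quotient.mk_eq_zero]
  rfl

/-- A map is injective on homology if and only if homogeneous cycles that become boundaries are
boundaries of homogeneous elements. -/
theorem homologyMap_injective_iff {A B : CDGA R δ} (f : A ⟶ B) :
    Function.Injective (homologyMap f) ↔
      ∀ n, ∀ z ∈ A.grading (n + δ), A.d z = 0 → ∀ b ∈ B.grading n, f.toAlgHom z = B.d b →
        ∃ a ∈ A.grading n, A.d a = z := by
  rw [injective_iff_map_eq_zero]
  constructor
  · intro h n z hz hdz b _ hfz
    obtain ⟨a, ha⟩ := (homology_mk_eq_zero ⟨z, hdz⟩).1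
      (h _ ((homology_mk_eq_zero (cyclesMap f ⟨z, hdz⟩)).2 ⟨b, hfz.symm⟩))
    exact ⟨A.proj n a, A.proj_mem n a, by rw [d_proj, ha]; exact proj_same hz⟩
  · intro h x
    obtain ⟨⟨z, hdz⟩, rfl⟩ := Submodule.Quotient.mk_surjective _ x
    intro hx
    obtain ⟨b, hb⟩ := (homology_mk_eq_zero (cyclesMap f ⟨z, hdz⟩)).1 hx
    have hb : B.d b = f.toAlgHom z := hb
    have hdz : A.d z = 0 := hdz
    rw [homology_mk_eq_zero]
    have hn : ∀ n, ∃ a, A.d a = A.proj n z := by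
      intro n
      obtain ⟨a, -, ha⟩ := h (n - δ) (A.proj n z) (by simpa using A.proj_mem n z)
        (by rw [d_proj, hdz, map_zero]) (B.proj (n - δ) b) (B.proj_mem _ b)
        (by rw [d_proj, hb, hom_proj]; simp)
      exact ⟨a, ha⟩
    choose a ha using hn
    obtain ⟨s, hs⟩ := exists_finset_sum_proj z
    exact ⟨∑ n ∈ s, a n, by rw [map_sum]; simp only [ha]; exact hs.symm⟩

/-- A map is surjective on homology if and only if every homogeneous cycle is homologous to the
image of a homogeneous cycle. -/
theorem homologyMap_surjective_iff {A B : CDGA R δ} (f : A ⟶ B) :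
    Function.Surjective (homologyMap f) ↔
      ∀ n, ∀ b ∈ B.grading n, B.d b = 0 →
        ∃ z ∈ A.grading n, A.d z = 0 ∧ ∃ b' ∈ B.grading (n - δ), f.toAlgHom z = b + B.d b' := by
  constructor
  · intro h n b hb hdb
    obtain ⟨x, hx⟩ := h (Submodule.Quotient.mk ⟨b, hdb⟩)
    obtain ⟨⟨z, hdz⟩, rfl⟩ := Submodule.Quotient.mk_surjective _ x
    rw [homologyMap_mk, ← sub_eq_zero, ← Submodule.Quotient.mk_sub, homology_mk_eq_zero] at hx
    obtain ⟨b', hb'⟩ := hx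
    have hb' : B.d b' = f.toAlgHom z - b := hb'
    have hdz : A.d z = 0 := hdz
    refine ⟨A.proj n z, A.proj_mem n z, by rw [d_proj, hdz, map_zero], B.proj (n - δ) b',
      B.proj_mem _ _, ?_⟩
    rw [hom_proj, d_proj, hb', map_sub]
    simp [proj_same hb]
  · intro h x
    obtain ⟨⟨b, hdb⟩, rfl⟩ := Submodule.Quotient.mk_surjective _ x
    have hdb : B.d b = 0 := hdb
    have hn : ∀ n, ∃ z, A.d z = 0 ∧ ∃ b', f.toAlgHom z = B.proj n b + B.d b' := by
      intro n
      obtain ⟨z, -, hz, b', -, hb'⟩ := h n (B.proj n b) (B.proj_mem n b)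
        (by rw [d_proj, hdb, map_zero])
      exact ⟨z, hz, b', hb'⟩
    choose z hz b' hb' using hn
    obtain ⟨s, hs⟩ := exists_finset_sum_proj b
    refine ⟨Submodule.Quotient.mk ⟨∑ n ∈ s, z n, ?_⟩, ?_⟩
    · rw [LinearMap.mem_ker, map_sum]
      exact Finset.sum_eq_zero fun n _ => hz n
    · rw [homologyMap_mk, ← sub_eq_zero, ← Submodule.Quotient.mk_sub, homology_mk_eq_zero]
      refine ⟨∑ n ∈ s, b' n, ?_⟩
      change _ = f.toAlgHom (∑ n ∈ s, z n) - b
      rw [map_sum, map_sum]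
      conv_rhs => rw [hs]
      rw [← Finset.sum_sub_distrib]
      exact Finset.sum_congr rfl fun n _ => by rw [hb']; abel

/-- The right lifting property in degree `n` against the cells `S(z) → S(x, dx = z)` up to
boundaries: a cycle `z` of degree `n + δ` together with a primitive `a` of its image is the boundary
of an element `u` whose image is homologous to `a`. -/
def FillsCells {A B : CDGA R δ} (f : A ⟶ B) (n : ℤ) : Prop :=
  ∀ z ∈ A.grading (n + δ), A.d z = 0 → ∀ b ∈ B.grading n, f.toAlgHom z = B.d b →
    ∃ u ∈ A.grading n, A.d u = z ∧ ∃ b' ∈ B.grading (n - δ), f.toAlgHom u = b + B.d b'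

theorem isQuasiIso_of_fillsCells {A B : CDGA R δ} (f : A ⟶ B) (h : ∀ n, FillsCells f n) :
    IsQuasiIso f := by
  refine ⟨(homologyMap_injective_iff f).2 ?_, (homologyMap_surjective_iff f).2 ?_⟩
  · intro n z hz hdz b hb hfz
    obtain ⟨u, hu, hdu, -⟩ := h n z hz hdz b hb hfz
    exact ⟨u, hu, hdu⟩
  · intro n b hb hdb
    exact h n 0 (Submodule.zero_mem _) (map_zero _) b hb (by rw [hdb, map_zero])

theorem isQuasiIso_of_inverse {A B : CDGA R δ} (f : A ⟶ B) (g : B ⟶ A) (h₁ : f ≫ g = 𝟙 A)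
    (h₂ : g ≫ f = 𝟙 B) : IsQuasiIso f := by
  have hgf : ∀ a, g.toAlgHom (f.toAlgHom a) = a := fun a => by rw [← comp_apply, h₁, id_apply]
  have hfg : ∀ b, f.toAlgHom (g.toAlgHom b) = b := fun b => by rw [← comp_apply, h₂, id_apply]
  refine isQuasiIso_of_fillsCells f fun n z _ _ b hb hfz => ⟨g.toAlgHom b, g.map_mem hb, ?_, 0,
    Submodule.zero_mem _, by rw [hfg, map_zero, add_zero]⟩
  rw [← g.map_d, ← hfz, hgf]

/-- Surjective quasi-isomorphisms lift cells strictly. -/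
theorem exists_lift_of_acyclicFibration {A B : CDGA R δ} (p : A ⟶ B)
    (hp : Function.Surjective p.toAlgHom) (hq : IsQuasiIso p) {n : ℤ} {z : A}
    (hz : z ∈ A.grading (n + δ)) (hdz : A.d z = 0) {b : B} (hb : b ∈ B.grading n)
    (h : p.toAlgHom z = B.d b) : ∃ c ∈ A.grading n, A.d c = z ∧ p.toAlgHom c = b := by
  obtain ⟨c₁, hc₁, hdc₁⟩ := (homologyMap_injective_iff p).1 hq.1 n z hz hdz b hb h
  obtain ⟨c₂, hc₂, hdc₂, b', hb', hpc₂⟩ := (homologyMap_surjective_iff p).1 hq.2 n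
    (b - p.toAlgHom c₁) (Submodule.sub_mem _ hb (p.map_mem hc₁))
    (by rw [map_sub, ← p.map_d, hdc₁, h, sub_self])
  obtain ⟨c₃, hc₃⟩ := hp b'
  have hpc₃ : p.toAlgHom (A.proj (n - δ) c₃) = b' := by rw [hom_proj, hc₃, proj_same hb']
  refine ⟨c₁ + c₂ - A.d (A.proj (n - δ) c₃), ?_, ?_, ?_⟩
  · refine Submodule.sub_mem _ (Submodule.add_mem _ hc₁ hc₂) ?_
    simpa using A.d_mem (A.proj_mem (n - δ) c₃)
  · rw [map_sub, map_add, hdc₁, hdc₂, A.d_d, add_zero, sub_zero]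
  · rw [map_sub, map_add, hpc₂, p.map_d, hpc₃]
    abel

end CDGA

/-! ### Gradings by monomials -/

section MonomialGrading

variable {R : Type*} [CommRing R] {A : Type*} [Ring A] [Algebra R A] (g : ℤ → Set A)

/-- The products of elements of `⋃ n, g n`, where the elements of `g n` count as being of degree
`n`. -/
inductive IsMonomial : ℤ → A → Prop
  | one : IsMonomial 0 1
  | mul {m n : ℤ} {s a : A} : s ∈ g m → IsMonomial n a → IsMonomial (m + n) (s * a)

variable (R) in
/-- The span of the monomials of degree `n` in the generators `g`. -/
def monomialGrading (n : ℤ) : Submodule R A := Submodule.span R {a | IsMonomial g n a}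

variable {g}

theorem IsMonomial.mul_mem {m n : ℤ} {a b : A} (ha : IsMonomial g m a) (hb : IsMonomial g n b) :
    IsMonomial g (m + n) (a * b) := by
  induction ha with
  | one => simpa using hb
  | mul hs _ ih => rw [mul_assoc, add_assoc]; exact .mul hs ih

theorem mem_monomialGrading_of_mem {n : ℤ} {s : A} (hs : s ∈ g n) : s ∈ monomialGrading R g n :=
  Submodule.subset_span (by simpa using IsMonomial.mul hs .one)

theorem one_mem_monomialGrading : (1 : A) ∈ monomialGrading R g 0 := Submodule.subset_span .one

theorem mul_mem_monomialGrading {m n : ℤ} {a b : A} (ha : a ∈ monomialGrading R g m)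
    (hb : b ∈ monomialGrading R g n) : a * b ∈ monomialGrading R g (m + n) := by
  have h := Submodule.mul_mem_mul ha hb
  rw [monomialGrading, monomialGrading, Submodule.span_mul_span] at h
  refine Submodule.span_mono ?_ h
  rintro _ ⟨x, hx, y, hy, rfl⟩
  exact hx.mul_mem hy

/-- Submodules that are stable under left multiplication by the generators contain the homogeneous
parts. -/
theorem monomialGrading_le {p : ℤ → Submodule R A} (h_one : 1 ∈ p 0)
    (h_mul : ∀ m n, ∀ s ∈ g m, ∀ a ∈ monomialGrading R g n, a ∈ p n → s * a ∈ p (m + n)) (n : ℤ) :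
    monomialGrading R g n ≤ p n := by
  refine Submodule.span_le.2 fun a ha => ?_
  induction ha with
  | one => exact h_one
  | mul hs ha ih => exact h_mul _ _ _ hs _ (Submodule.subset_span ha) ih

theorem iSup_monomialGrading (hg : Algebra.adjoin R (⋃ n, g n) = ⊤) :
    ⨆ n, monomialGrading R g n = ⊤ := by
  rw [eq_top_iff, ← Algebra.top_toSubmodule, ← hg, Algebra.adjoin_eq_span, Submodule.span_le]
  intro a ha
  suffices h : ∃ n, IsMonomial g n a by
    obtain ⟨n, hn⟩ := h
    exact Submodule.mem_iSup_of_mem n (Submodule.subset_span hn)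
  induction ha using Submonoid.closure_induction with
  | mem x hx =>
    obtain ⟨n, hn⟩ := Set.mem_iUnion.1 hx
    exact ⟨n + 0, by simpa using IsMonomial.mul hn .one⟩
  | one => exact ⟨0, .one⟩
  | mul x y _ _ hx hy =>
    obtain ⟨m, hm⟩ := hx
    obtain ⟨n, hn⟩ := hy
    exact ⟨m + n, hm.mul_mem hn⟩

/-- A map `a ↦ a T ^ n` to Laurent polynomials separates the monomials of different degrees. -/
theorem isInternal_monomialGrading (hg : Algebra.adjoin R (⋃ n, g n) = ⊤)
    (κ : A →ₐ[R] AddMonoidAlgebra A ℤ)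
    (hκ : ∀ n, ∀ s ∈ g n, κ s = AddMonoidAlgebra.single n s) :
    DirectSum.IsInternal (monomialGrading R g) := by
  have key : ∀ n, ∀ a ∈ monomialGrading R g n, κ a = AddMonoidAlgebra.single n a := by
    intro n a ha
    induction ha using Submodule.span_induction with
    | mem a ha =>
      induction ha with
      | one => exact map_one κ
      | mul hs _ ih => rw [map_mul, hκ _ _ hs, ih, AddMonoidAlgebra.single_mul_single]
    | zero => simp
    | add a b _ _ ha hb => rw [map_add, ha, hb, AddMonoidAlgebra.single_add]
    | smul r a _ ha => rw [map_smul, ha, AddMonoidAlgebra.smul_single]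
  refine DirectSum.isInternal_of_projections _
    (fun n => ⟨⟨fun a => (κ a).coeff n, by simp⟩, fun a b => by simp⟩) ?_ ?_
    (iSup_monomialGrading hg)
  · intro n a ha
    change (κ a).coeff n = a
    rw [key n a ha, AddMonoidAlgebra.coeff_single, Finsupp.single_eq_same]
  · intro m n hmn a ha
    change (κ a).coeff n = 0
    rw [key m a ha, AddMonoidAlgebra.coeff_single, Finsupp.single_eq_of_ne hmn.symm]

theorem monomialGrading_graded_comm
    (hg : ∀ m n, ∀ s ∈ g m, ∀ t ∈ g n, s * t = (m * n).negOnePow • (t * s)) {m n : ℤ} {a b : A}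
    (ha : a ∈ monomialGrading R g m) (hb : b ∈ monomialGrading R g n) :
    a * b = (m * n).negOnePow • (b * a) := by
  have h₁ : ∀ m n, ∀ s ∈ g m, ∀ b, IsMonomial g n b → s * b = (m * n).negOnePow • (b * s) := by
    intro m n s hs b hb
    induction hb with
    | one => simp
    | @mul p q t b ht _ ih =>
      rw [← mul_assoc, hg _ _ _ hs _ ht, smul_mul_assoc, mul_assoc, ih, mul_smul_comm, smul_smul,
        ← Int.negOnePow_add, ← mul_add, mul_assoc]
  have h₂ : ∀ m n a b, IsMonomial g m a → IsMonomial g n b →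
      a * b = (m * n).negOnePow • (b * a) := by
    intro m n a b ha hb
    induction ha with
    | one => simp
    | @mul p q t a ht _ ih =>
      rw [mul_assoc, ih, mul_smul_comm, ← mul_assoc, h₁ _ _ _ ht _ hb, smul_mul_assoc, smul_smul,
        ← Int.negOnePow_add, mul_assoc, add_mul, add_comm]
  have hsmul : ∀ (k : ℤ) (r : R) (x : A), r • (k.negOnePow • x) = k.negOnePow • (r • x) :=
    fun k r x => smul_comm _ _ _
  induction ha using Submodule.span_induction with
  | mem a ha =>
    induction hb using Submodule.span_induction with
    | mem b hb => exact h₂ _ _ _ _ ha hb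
    | zero => simp
    | add b c _ _ hb hc => rw [mul_add, add_mul, smul_add, hb, hc]
    | smul r b _ hb => rw [mul_smul_comm, smul_mul_assoc, hb, hsmul]
  | zero => simp
  | add a c _ _ ha hc => rw [mul_add, add_mul, smul_add, ha, hc]
  | smul r a _ ha => rw [mul_smul_comm, smul_mul_assoc, ha, hsmul]

end MonomialGrading

namespace CDGA

variable {R : Type u} [CommRing R] {δ : ℤ}

/-! ### Adjoining free generators -/

/-- The relations that make the map `B → FreeAlgebra R (B ⊕ X)` an algebra map and the variables
graded-commute with `B` and with each other. -/
inductive AdjoinRel (B : CDGA R δ) {X : Type u} (deg : X → ℤ) :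
    FreeAlgebra R (B ⊕ X) → FreeAlgebra R (B ⊕ X) → Prop
  | add (a b : B) : AdjoinRel B deg (FreeAlgebra.ι R (.inl (a + b)))
      (FreeAlgebra.ι R (.inl a) + FreeAlgebra.ι R (.inl b))
  | mul (a b : B) : AdjoinRel B deg (FreeAlgebra.ι R (.inl (a * b)))
      (FreeAlgebra.ι R (.inl a) * FreeAlgebra.ι R (.inl b))
  | algebraMap (r : R) : AdjoinRel B deg (FreeAlgebra.ι R (.inl (algebraMap R B r)))
      (algebraMap R _ r)
  | comm {n : ℤ} {a : B} (ha : a ∈ B.grading n) (x : X) : AdjoinRel B deg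
      (FreeAlgebra.ι R (.inl a) * FreeAlgebra.ι R (.inr x))
      ((n * deg x).negOnePow • (FreeAlgebra.ι R (.inr x) * FreeAlgebra.ι R (.inl a)))
  | swap (x y : X) : AdjoinRel B deg
      (FreeAlgebra.ι R (.inr x) * FreeAlgebra.ι R (.inr y))
      ((deg x * deg y).negOnePow • (FreeAlgebra.ι R (.inr y) * FreeAlgebra.ι R (.inr x)))

/-- The graded algebra `B ⊗ S(V)`, where `V` is free on the homogeneous basis `X`. -/
abbrev AdjoinAlgebra (B : CDGA R δ) {X : Type u} (deg : X → ℤ) : Type u :=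
  RingQuot (AdjoinRel B deg)

namespace AdjoinAlgebra

variable (B : CDGA R δ) {X : Type u} (deg : X → ℤ)

/-- The inclusion of the base. -/
def incl : B →ₐ[R] AdjoinAlgebra B deg where
  toFun b := RingQuot.mkAlgHom R (AdjoinRel B deg) (FreeAlgebra.ι R (.inl b))
  map_add' a b := by rw [RingQuot.mkAlgHom_rel R (.add a b), map_add]
  map_mul' a b := by rw [RingQuot.mkAlgHom_rel R (.mul a b), map_mul]
  commutes' r := by rw [RingQuot.mkAlgHom_rel R (.algebraMap r), AlgHom.commutes]
  map_zero' := by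
    have h := RingQuot.mkAlgHom_rel R (AdjoinRel.algebraMap (B := B) (deg := deg) 0)
    rwa [map_zero, map_zero, map_zero] at h
  map_one' := by
    have h := RingQuot.mkAlgHom_rel R (AdjoinRel.algebraMap (B := B) (deg := deg) 1)
    rwa [map_one, map_one, map_one] at h

/-- The new generators. -/
def var (x : X) : AdjoinAlgebra B deg :=
  RingQuot.mkAlgHom R (AdjoinRel B deg) (FreeAlgebra.ι R (.inr x))

variable {B deg}

theorem incl_mul_var {n : ℤ} {a : B} (ha : a ∈ B.grading n) (x : X) :
    incl B deg a * var B deg x = (n * deg x).negOnePow • (var B deg x * incl B deg a) := by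
  have h := RingQuot.mkAlgHom_rel R (AdjoinRel.comm (deg := deg) ha x)
  rwa [map_mul, map_negOnePow_smul, map_mul] at h

theorem var_mul_var (x y : X) :
    var B deg x * var B deg y = (deg x * deg y).negOnePow • (var B deg y * var B deg x) := by
  have h := RingQuot.mkAlgHom_rel R (AdjoinRel.swap (B := B) (deg := deg) x y)
  rwa [map_mul, map_negOnePow_smul, map_mul] at h

section lift

variable {C : Type*} [Ring C] [Algebra R C] (g : B →ₐ[R] C) (c : X → C)
  (h₁ : ∀ n, ∀ a ∈ B.grading n, ∀ x, g a * c x = (n * deg x).negOnePow • (c x * g a))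
  (h₂ : ∀ x y, c x * c y = (deg x * deg y).negOnePow • (c y * c x))

/-- The universal property of `B ⊗ S(V)`. -/
def lift : AdjoinAlgebra B deg →ₐ[R] C :=
  RingQuot.liftAlgHom R ⟨FreeAlgebra.lift R (Sum.elim g c), by
    intro a b h
    cases h with
    | add => simp
    | mul => simp
    | algebraMap r => simp
    | comm ha x => simpa [map_negOnePow_smul] using h₁ _ _ ha x
    | swap x y => simpa [map_negOnePow_smul] using h₂ x y⟩

@[simp]
theorem lift_incl (b : B) : lift g c h₁ h₂ (incl B deg b) = g b := by
  simp [lift, incl, RingQuot.liftAlgHom_mkAlgHom_apply]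

@[simp]
theorem lift_var (x : X) : lift g c h₁ h₂ (var B deg x) = c x := by
  simp [lift, var, RingQuot.liftAlgHom_mkAlgHom_apply]

end lift

theorem algHom_ext {C : Type*} [Ring C] [Algebra R C] {f g : AdjoinAlgebra B deg →ₐ[R] C}
    (h₁ : ∀ b, f (incl B deg b) = g (incl B deg b)) (h₂ : ∀ x, f (var B deg x) = g (var B deg x)) :
    f = g := by
  refine RingQuot.ringQuot_ext' R _ _ (FreeAlgebra.hom_ext (funext ?_))
  rintro (b | x)
  · exact h₁ b
  · exact h₂ x

variable (B deg) in
/-- The homogeneous generators of degree `n`. -/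
def generators (n : ℤ) : Set (AdjoinAlgebra B deg) :=
  incl B deg '' B.grading n ∪ var B deg '' {x | deg x = n}

theorem adjoin_range : Algebra.adjoin R
    (Set.range (incl B deg) ∪ Set.range (var B deg)) = ⊤ := by
  rw [Algebra.eq_top_iff]
  intro a
  obtain ⟨a, rfl⟩ := RingQuot.mkAlgHom_surjective R _ a
  induction a using FreeAlgebra.induction with
  | grade0 r => rw [AlgHom.commutes]; exact Subalgebra.algebraMap_mem _ r
  | grade1 x =>
    refine Algebra.subset_adjoin ?_
    rcases x with b | x
    · exact Or.inl ⟨b, rfl⟩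
    · exact Or.inr ⟨x, rfl⟩
  | mul a b ha hb => rw [map_mul]; exact Subalgebra.mul_mem _ ha hb
  | add a b ha hb => rw [map_add]; exact Subalgebra.add_mem _ ha hb

theorem adjoin_generators : Algebra.adjoin R (⋃ n, generators B deg n) = ⊤ := by
  rw [eq_top_iff, ← adjoin_range, Algebra.adjoin_le_iff]
  rintro _ (⟨b, rfl⟩ | ⟨x, rfl⟩)
  · induction b using homogeneous_induction with
    | h n b hb => exact Algebra.subset_adjoin (Set.mem_iUnion.2 ⟨n, Or.inl ⟨b, hb, rfl⟩⟩)
    | hadd a b ha hb => rw [map_add]; exact Subalgebra.add_mem _ ha hb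
  · exact Algebra.subset_adjoin (Set.mem_iUnion.2 ⟨deg x, Or.inr ⟨x, rfl, rfl⟩⟩)

theorem generators_comm (m n : ℤ) (s : AdjoinAlgebra B deg) (hs : s ∈ generators B deg m)
    (t : AdjoinAlgebra B deg) (ht : t ∈ generators B deg n) :
    s * t = (m * n).negOnePow • (t * s) := by
  rcases hs with ⟨a, ha, rfl⟩ | ⟨x, rfl, rfl⟩ <;> rcases ht with ⟨b, hb, rfl⟩ | ⟨y, rfl, rfl⟩
  · rw [← map_mul, ← map_mul, B.graded_comm ha hb, map_negOnePow_smul]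
  · exact incl_mul_var ha y
  · rw [incl_mul_var hb x, smul_smul, ← Int.negOnePow_add, mul_comm n, ← two_mul,
      Int.negOnePow_two_mul, one_smul]
  · exact var_mul_var x y

theorem single_negOnePow_smul {A : Type*} [Ring A] (m n : ℤ) (a : A) :
    AddMonoidAlgebra.single m (n.negOnePow • a) =
      n.negOnePow • (AddMonoidAlgebra.single m a : AddMonoidAlgebra A ℤ) :=
  map_negOnePow_smul (AddMonoidAlgebra.lsingle (R := ℤ) m) n a

/-- The map `b ↦ b T ^ n`, for `b ∈ B` homogeneous of degree `n`. -/
noncomputable def laurentIncl : B →ₐ[R] AddMonoidAlgebra (AdjoinAlgebra B deg) ℤ :=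
  let f (n : ℤ) : B →ₗ[R] AddMonoidAlgebra (AdjoinAlgebra B deg) ℤ :=
    AddMonoidAlgebra.lsingle n ∘ₗ (incl B deg).toLinearMap
  have hf (n : ℤ) (b : B) : f n b = AddMonoidAlgebra.single n (incl B deg b) := rfl
  gradedLift (C := AddMonoidAlgebra (AdjoinAlgebra B deg) ℤ) f (by rw [hf, map_one]; rfl)
    (fun m n a _ b _ => by simp only [hf, map_mul, AddMonoidAlgebra.single_mul_single])

theorem laurentIncl_of_mem {n : ℤ} {a : B} (ha : a ∈ B.grading n) :
    laurentIncl a = AddMonoidAlgebra.single n (incl B deg a) :=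
  gradedLift_of_mem _ _ _ ha

/-- The map `a ↦ a T ^ n`, for `a` homogeneous of degree `n`. -/
noncomputable def coaction : AdjoinAlgebra B deg →ₐ[R] AddMonoidAlgebra (AdjoinAlgebra B deg) ℤ :=
  lift laurentIncl (fun x => AddMonoidAlgebra.single (deg x) (var B deg x))
    (fun n a ha x => by
      rw [laurentIncl_of_mem ha, AddMonoidAlgebra.single_mul_single,
        AddMonoidAlgebra.single_mul_single, incl_mul_var ha, single_negOnePow_smul, add_comm])
    (fun x y => by
      rw [AddMonoidAlgebra.single_mul_single, AddMonoidAlgebra.single_mul_single, var_mul_var,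
        single_negOnePow_smul, add_comm])

theorem coaction_generators (n : ℤ) (s : AdjoinAlgebra B deg) (hs : s ∈ generators B deg n) :
    coaction s = AddMonoidAlgebra.single n s := by
  rcases hs with ⟨a, ha, rfl⟩ | ⟨x, rfl, rfl⟩
  · rw [coaction, lift_incl, laurentIncl_of_mem ha]
  · rw [coaction, lift_var]

theorem isInternal : DirectSum.IsInternal (monomialGrading R (generators B deg)) :=
  isInternal_monomialGrading adjoin_generators coaction coaction_generators

/-- The sign involution. -/
noncomputable def signHom : AdjoinAlgebra B deg →ₐ[R] AdjoinAlgebra B deg :=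
  lift ((incl B deg).comp B.sign) (fun x => (deg x).negOnePow • var B deg x)
    (fun n a ha x => by
      rw [AlgHom.comp_apply, sign_of_mem ha, map_negOnePow_smul, smul_mul_smul_comm,
        smul_mul_smul_comm, incl_mul_var ha, mul_comm (deg x).negOnePow, smul_comm])
    (fun x y => by
      rw [smul_mul_smul_comm, smul_mul_smul_comm, var_mul_var, mul_comm (deg x).negOnePow,
        smul_comm])

theorem signHom_of_mem {n : ℤ} {a : AdjoinAlgebra B deg}
    (ha : a ∈ monomialGrading R (generators B deg) n) : signHom a = n.negOnePow • a := by
  have h : monomialGrading R (generators B deg) n ≤ LinearMap.eqLocus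
      (signHom (B := B) (deg := deg)).toLinearMap ((n.negOnePow : ℤ) • LinearMap.id) := by
    refine monomialGrading_le (p := fun n => LinearMap.eqLocus
      (signHom (B := B) (deg := deg)).toLinearMap ((n.negOnePow : ℤ) • LinearMap.id)) ?_ ?_ n
    · simp [LinearMap.mem_eqLocus]
    · intro m n s hs a _ ha
      have ha : signHom a = n.negOnePow • a := ha
      change signHom (s * a) = (m + n).negOnePow • (s * a)
      have h : signHom s = m.negOnePow • s := by
        rcases hs with ⟨b, hb, rfl⟩ | ⟨x, rfl, rfl⟩
        · rw [signHom, lift_incl, AlgHom.comp_apply, sign_of_mem hb, map_negOnePow_smul]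
        · rw [signHom, lift_var]
      rw [map_mul, h, ha, smul_mul_smul_comm, Int.negOnePow_add]
  exact h ha

end AdjoinAlgebra

end CDGA

namespace CDGA

variable {R : Type u} [CommRing R] {δ : ℤ}

theorem negOnePow_mul_add_odd (hδ : Odd δ) (m n : ℤ) :
    (m * (n + δ)).negOnePow = (m * n).negOnePow * m.negOnePow := by
  rw [← Int.negOnePow_add, Int.negOnePow_eq_iff]
  obtain ⟨c, rfl⟩ := hδ
  exact ⟨m * c, by ring⟩

/-- The graded commutation of `s` and `t` is inherited by the matrices that encode the Leibniz
rule. -/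
theorem leibnizMatrix_comm {A : Type*} [Ring A] (hδ : Odd δ) {p q : ℤ} {s t ds dt : A}
    (h : s * t = (p * q).negOnePow • (t * s)) (h₁ : s * dt = (p * (q + δ)).negOnePow • (dt * s))
    (h₂ : ds * t = ((p + δ) * q).negOnePow • (t * ds)) :
    !![p.negOnePow • s, ds; 0, s] * !![q.negOnePow • t, dt; 0, t] =
      (p * q).negOnePow •
        (!![q.negOnePow • t, dt; 0, t] * !![p.negOnePow • s, ds; 0, s]) := by
  have e₂ : ((p + δ) * q).negOnePow = (p * q).negOnePow * q.negOnePow := by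
    rw [mul_comm, negOnePow_mul_add_odd hδ, mul_comm q p]
  rw [Matrix.mul_fin_two, Matrix.mul_fin_two]
  ext i j
  fin_cases i <;> fin_cases j
  · simp [h, smul_mul_smul_comm, smul_smul, mul_comm]
  · have h₁' : p.negOnePow • s * dt = (p * q).negOnePow • (dt * s) := by
      rw [smul_mul_assoc, h₁, negOnePow_mul_add_odd hδ, smul_smul, mul_left_comm,
        Int.units_mul_self, mul_one]
    have h₂' : ds * t = (p * q).negOnePow • (q.negOnePow • t * ds) := by
      rw [h₂, e₂, smul_mul_assoc, smul_smul]
    change p.negOnePow • s * dt + ds * t =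
      (p * q).negOnePow • (q.negOnePow • t * ds + dt * s)
    rw [h₁', h₂', smul_add, add_comm]
  · simp
  · simpa using h

namespace AdjoinAlgebra

variable {B : CDGA R δ} {X : Type u} {deg : X → ℤ}

/-- The algebra map `b ↦ (± b, d b; 0, b)` that encodes the Leibniz rule on `B`. -/
noncomputable def inclMatrix : B →ₐ[R] Matrix (Fin 2) (Fin 2) (AdjoinAlgebra B deg) :=
  AlgHom.ofLinearMap
    { toFun := fun b => !![incl B deg (B.sign b), incl B deg (B.d b); 0, incl B deg b]
      map_add' := fun a b => by
        ext i j; fin_cases i <;> fin_cases j <;> simp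
      map_smul' := fun r b => by
        ext i j; fin_cases i <;> fin_cases j <;> simp }
    (by ext i j; fin_cases i <;> fin_cases j <;> simp [d_one])
    (fun a b => by
      change !![_, _; 0, _] = !![_, _; 0, _] * !![_, _; 0, _]
      rw [Matrix.mul_fin_two, d_mul]
      ext i j; fin_cases i <;> fin_cases j <;> simp [add_comm])

theorem inclMatrix_apply (b : B) : inclMatrix (deg := deg) b =
    !![incl B deg (B.sign b), incl B deg (B.d b); 0, incl B deg b] := rfl

section differential

variable (hδ : Odd δ) (z : X → B) (hz : ∀ x, z x ∈ B.grading (deg x + δ))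

/-- The algebra map `a ↦ (± a, d a; 0, a)` that encodes the Leibniz rule for the differential with
`d x = z x` on the new generators. -/
noncomputable def leibnizMatrix :
    AdjoinAlgebra B deg →ₐ[R] Matrix (Fin 2) (Fin 2) (AdjoinAlgebra B deg) :=
  lift inclMatrix
    (fun x => !![(deg x).negOnePow • var B deg x, incl B deg (z x); 0, var B deg x])
    (fun n a ha x => by
      rw [inclMatrix_apply, sign_of_mem ha, map_negOnePow_smul]
      exact leibnizMatrix_comm hδ (incl_mul_var ha x)
        (generators_comm _ _ _ (Or.inl ⟨a, ha, rfl⟩) _ (Or.inl ⟨z x, hz x, rfl⟩))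
        (generators_comm _ _ _ (Or.inl ⟨_, B.d_mem ha, rfl⟩) _ (Or.inr ⟨x, rfl, rfl⟩)))
    (fun x y => leibnizMatrix_comm hδ (var_mul_var x y)
        (generators_comm _ _ _ (Or.inr ⟨x, rfl, rfl⟩) _ (Or.inl ⟨z y, hz y, rfl⟩))
        (generators_comm _ _ _ (Or.inl ⟨z x, hz x, rfl⟩) _ (Or.inr ⟨y, rfl, rfl⟩)))

/-- The differential with `d x = z x` on the new generators. -/
noncomputable def diff : AdjoinAlgebra B deg →ₗ[R] AdjoinAlgebra B deg where
  toFun a := leibnizMatrix hδ z hz a 0 1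
  map_add' a b := by simp
  map_smul' r a := by simp

theorem leibnizMatrix_apply (a : AdjoinAlgebra B deg) :
    leibnizMatrix hδ z hz a = !![signHom a, diff hδ z hz a; 0, a] := by
  suffices h : leibnizMatrix hδ z hz a 0 0 = signHom a ∧ leibnizMatrix hδ z hz a 1 0 = 0 ∧
      leibnizMatrix hδ z hz a 1 1 = a by
    ext i j
    fin_cases i <;> fin_cases j
    exacts [h.1, rfl, h.2.1, h.2.2]
  have ha : a ∈ Algebra.adjoin R (Set.range (incl B deg) ∪ Set.range (var B deg)) := by
    rw [adjoin_range]; trivial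
  induction ha using Algebra.adjoin_induction with
  | mem a ha =>
    rcases ha with ⟨b, rfl⟩ | ⟨x, rfl⟩
    · simp [leibnizMatrix, signHom, inclMatrix_apply]
    · simp [leibnizMatrix, signHom]
  | algebraMap r => simp [Matrix.algebraMap_matrix_apply]
  | add a b _ _ ha hb => simp [ha, hb]
  | mul a b _ _ ha hb => simp [Matrix.mul_apply, Fin.sum_univ_two, ha, hb]

theorem diff_mul (a b : AdjoinAlgebra B deg) :
    diff hδ z hz (a * b) = diff hδ z hz a * b + signHom a * diff hδ z hz b := by
  have h := congrFun₂ (map_mul (leibnizMatrix hδ z hz) a b) 0 1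
  rw [leibnizMatrix_apply, leibnizMatrix_apply, leibnizMatrix_apply, Matrix.mul_fin_two] at h
  simpa [add_comm] using h

@[simp]
theorem diff_incl (b : B) : diff hδ z hz (incl B deg b) = incl B deg (B.d b) := by
  simp [diff, leibnizMatrix, inclMatrix_apply]

@[simp]
theorem diff_var (x : X) : diff hδ z hz (var B deg x) = incl B deg (z x) := by
  simp [diff, leibnizMatrix]

theorem diff_mem {n : ℤ} {a : AdjoinAlgebra B deg}
    (ha : a ∈ monomialGrading R (generators B deg) n) :
    diff hδ z hz a ∈ monomialGrading R (generators B deg) (n + δ) := by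
  refine monomialGrading_le (p := fun n =>
    (monomialGrading R (generators B deg) (n + δ)).comap (diff hδ z hz)) ?_ ?_ n ha
  · rw [Submodule.mem_comap, ← map_one (incl B deg), diff_incl, d_one, map_zero]
    exact Submodule.zero_mem _
  · intro m n s hs a ha' ha
    rw [Submodule.mem_comap] at ha ⊢
    rw [diff_mul, signHom_of_mem (mem_monomialGrading_of_mem hs)]
    refine Submodule.add_mem _ ?_ ?_
    · have hds : diff hδ z hz s ∈ generators B deg (m + δ) := by
        rcases hs with ⟨b, hb, rfl⟩ | ⟨x, rfl, rfl⟩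
        · exact Or.inl ⟨_, B.d_mem hb, (diff_incl hδ z hz b).symm⟩
        · exact Or.inl ⟨_, hz x, (diff_var hδ z hz x).symm⟩
      rw [add_right_comm]
      exact mul_mem_monomialGrading (mem_monomialGrading_of_mem hds) ha'
    · rw [smul_mul_assoc, add_assoc]
      exact negOnePow_smul_mem _ _ (mul_mem_monomialGrading (mem_monomialGrading_of_mem hs) ha)

theorem diff_diff (hdz : ∀ x, B.d (z x) = 0) (a : AdjoinAlgebra B deg) :
    diff hδ z hz (diff hδ z hz a) = 0 := by
  have ha : a ∈ ⨆ n, monomialGrading R (generators B deg) n := by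
    rw [iSup_monomialGrading adjoin_generators]; trivial
  have hle : ∀ n, monomialGrading R (generators B deg) n ≤
      LinearMap.ker (diff hδ z hz ∘ₗ diff hδ z hz) := by
    refine monomialGrading_le ?_ ?_
    · rw [LinearMap.mem_ker, LinearMap.comp_apply, ← map_one (incl B deg), diff_incl, d_one,
        map_zero, map_zero]
    · intro m n s hs a _ ha
      have ha : diff hδ z hz (diff hδ z hz a) = 0 := ha
      have hs' := mem_monomialGrading_of_mem (R := R) hs
      have hdds : diff hδ z hz (diff hδ z hz s) = 0 := by
        rcases hs with ⟨b, hb, rfl⟩ | ⟨x, rfl, rfl⟩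
        · simp [B.d_d]
        · simp [hdz]
      have hsign : (m + δ).negOnePow = -m.negOnePow := by
        rw [Int.negOnePow_add, Int.negOnePow_odd δ hδ, mul_neg, mul_one]
      rw [LinearMap.mem_ker, LinearMap.comp_apply, diff_mul, map_add, diff_mul, hdds, zero_mul,
        zero_add, signHom_of_mem (diff_mem hδ z hz hs'), signHom_of_mem hs', smul_mul_assoc,
        smul_mul_assoc, map_negOnePow_smul, diff_mul, ha, mul_zero, add_zero, hsign]
      simp [Units.smul_def]
  exact iSup_le hle ha

end differential

end AdjoinAlgebra

open AdjoinAlgebra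

section adjoinCells

variable (hδ : Odd δ) (B : CDGA R δ) {X : Type u} (deg : X → ℤ) (z : X → B)
  (hz : ∀ x, z x ∈ B.grading (deg x + δ)) (hdz : ∀ x, B.d (z x) = 0)

/-- The cdg-algebra `B ⊗ S(V)` with `d x = z x` on a homogeneous basis `X` of `V`, where the `z x`
are cycles of `B`. -/
noncomputable def adjoinCells : CDGA R δ where
  carrier := AdjoinAlgebra B deg
  grading := monomialGrading R (generators B deg)
  isInternal := AdjoinAlgebra.isInternal
  one_mem := one_mem_monomialGrading
  mul_mem := mul_mem_monomialGrading
  graded_comm := monomialGrading_graded_comm generators_comm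
  d := diff hδ z hz
  d_mem := diff_mem hδ z hz
  d_d := diff_diff hδ z hz hdz
  leibniz b ha := by rw [diff_mul, signHom_of_mem ha, smul_mul_assoc]

namespace adjoinCells

/-- The inclusion of the base. -/
noncomputable def inclHom : B ⟶ adjoinCells hδ B deg z hz hdz where
  toAlgHom := incl B deg
  map_mem {_ a} ha := mem_monomialGrading_of_mem (Or.inl ⟨a, ha, rfl⟩)
  map_d a := (diff_incl hδ z hz a).symm

/-- The new generators. -/
noncomputable def cell (x : X) : adjoinCells hδ B deg z hz hdz := var B deg x

theorem cell_mem (x : X) : cell hδ B deg z hz hdz x ∈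
    (adjoinCells hδ B deg z hz hdz).grading (deg x) :=
  mem_monomialGrading_of_mem (Or.inr ⟨x, rfl, rfl⟩)

theorem d_cell (x : X) : (adjoinCells hδ B deg z hz hdz).d (cell hδ B deg z hz hdz x) =
    (inclHom hδ B deg z hz hdz).toAlgHom (z x) :=
  diff_var hδ z hz x

theorem adjoin_eq_top : Algebra.adjoin R (Set.range (inclHom hδ B deg z hz hdz).toAlgHom ∪
    Set.range (cell hδ B deg z hz hdz)) = ⊤ :=
  adjoin_range

variable {hδ B deg z hz hdz}

theorem algHom_ext {C : Type*} [Ring C] [Algebra R C] {f g : adjoinCells hδ B deg z hz hdz →ₐ[R] C}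
    (h₁ : ∀ b, f ((inclHom hδ B deg z hz hdz).toAlgHom b) =
      g ((inclHom hδ B deg z hz hdz).toAlgHom b))
    (h₂ : ∀ x, f (cell hδ B deg z hz hdz x) = g (cell hδ B deg z hz hdz x)) : f = g :=
  AdjoinAlgebra.algHom_ext h₁ h₂

section lift

variable {C : Type*} [Ring C] [Algebra R C] (g : B →ₐ[R] C) (c : X → C)
  (h₁ : ∀ n, ∀ a ∈ B.grading n, ∀ x, g a * c x = (n * deg x).negOnePow • (c x * g a))
  (h₂ : ∀ x y, c x * c y = (deg x * deg y).negOnePow • (c y * c x))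

variable (hδ z hz hdz) in
/-- The universal property of the underlying algebra. -/
noncomputable def lift : adjoinCells hδ B deg z hz hdz →ₐ[R] C := AdjoinAlgebra.lift g c h₁ h₂

@[simp]
theorem lift_incl (b : B) : lift hδ z hz hdz g c h₁ h₂
    ((inclHom hδ B deg z hz hdz).toAlgHom b) = g b :=
  AdjoinAlgebra.lift_incl _ _ _ _ b

@[simp]
theorem lift_cell (x : X) : lift hδ z hz hdz g c h₁ h₂ (cell hδ B deg z hz hdz x) = c x :=
  AdjoinAlgebra.lift_var _ _ _ _ x

end lift

section algLift

variable {C : CDGA R δ} (g : B →ₐ[R] C) (hg : ∀ n, ∀ b ∈ B.grading n, g b ∈ C.grading n)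
  (c : X → C) (hc : ∀ x, c x ∈ C.grading (deg x))

variable (hδ z hz hdz) in
/-- The universal property of the underlying graded algebra. -/
noncomputable def algLift : adjoinCells hδ B deg z hz hdz →ₐ[R] C :=
  lift hδ z hz hdz g c (fun _ a ha x => C.graded_comm (hg _ a ha) (hc x))
    (fun x y => C.graded_comm (hc x) (hc y))

@[simp]
theorem algLift_incl (b : B) : algLift hδ z hz hdz g hg c hc
    ((inclHom hδ B deg z hz hdz).toAlgHom b) = g b :=
  lift_incl _ _ _ _ b

@[simp]
theorem algLift_cell (x : X) : algLift hδ z hz hdz g hg c hc (cell hδ B deg z hz hdz x) = c x :=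
  lift_cell _ _ _ _ x

theorem algLift_mem {n : ℤ} {a : adjoinCells hδ B deg z hz hdz}
    (ha : a ∈ (adjoinCells hδ B deg z hz hdz).grading n) :
    algLift hδ z hz hdz g hg c hc a ∈ C.grading n := by
  refine monomialGrading_le (p := fun n =>
    (C.grading n).comap (algLift hδ z hz hdz g hg c hc).toLinearMap) ?_ ?_ n ha
  · rw [Submodule.mem_comap, AlgHom.toLinearMap_apply]
    exact (map_one (algLift hδ z hz hdz g hg c hc)).symm ▸ C.one_mem
  · intro m n s hs a _ ha
    have hs : algLift hδ z hz hdz g hg c hc s ∈ C.grading m := by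
      rcases hs with ⟨b, hb, rfl⟩ | ⟨x, rfl, rfl⟩
      · exact (algLift_incl g hg c hc b).symm ▸ hg _ b hb
      · exact (algLift_cell g hg c hc x).symm ▸ hc x
    have h := C.mul_mem hs ha
    rw [AlgHom.toLinearMap_apply, ← map_mul] at h
    exact h

end algLift

theorem inclHom_injective : Function.Injective (inclHom hδ B deg z hz hdz).toAlgHom :=
  Function.LeftInverse.injective (g := algLift hδ z hz hdz (AlgHom.id R B) (fun _ _ h => h) 0
    (fun _ => Submodule.zero_mem _)) fun b => algLift_incl _ _ _ _ b

/-- The universal property: a map out of `B ⊗ S(V)` is a map out of `B` together with primitives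
of the images of the cycles `z x`. -/
noncomputable def homLift {C : CDGA R δ} (g : B ⟶ C) (c : X → C)
    (hc : ∀ x, c x ∈ C.grading (deg x)) (hdc : ∀ x, C.d (c x) = g.toAlgHom (z x)) :
    adjoinCells hδ B deg z hz hdz ⟶ C where
  toAlgHom := algLift hδ z hz hdz g.toAlgHom (fun _ _ h => g.map_mem h) c hc
  map_mem ha := algLift_mem _ _ _ _ ha
  map_d a := by
    set φ := algLift hδ z hz hdz g.toAlgHom (fun _ _ h => g.map_mem h) c hc with hφ
    have ha : a ∈ Algebra.adjoin R (Set.range (inclHom hδ B deg z hz hdz).toAlgHom ∪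
        Set.range (cell hδ B deg z hz hdz)) := by
      rw [adjoin_eq_top]; trivial
    have hsign : ∀ a, φ ((adjoinCells hδ B deg z hz hdz).sign a) = C.sign (φ a) := by
      intro a
      induction a using homogeneous_induction with
      | h n a ha => rw [sign_of_mem ha, map_negOnePow_smul, sign_of_mem (algLift_mem _ _ _ _ ha)]
      | hadd a b ha hb => simp only [map_add, ha, hb]
    induction ha using Algebra.adjoin_induction with
    | mem a ha =>
      rcases ha with ⟨b, rfl⟩ | ⟨x, rfl⟩
      · rw [← Hom.map_d, hφ, algLift_incl, algLift_incl, g.map_d]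
      · rw [d_cell, hφ, algLift_incl, algLift_cell, hdc]
    | algebraMap r => rw [d_algebraMap, map_zero, AlgHom.commutes, d_algebraMap]
    | add a b _ _ ha hb => simp only [map_add, ha, hb]
    | mul a b _ _ ha hb => simp only [d_mul, map_add, map_mul, ha, hb, hsign]

section homLift

variable {C : CDGA R δ} (g : B ⟶ C) (c : X → C)
    (hc : ∀ x, c x ∈ C.grading (deg x)) (hdc : ∀ x, C.d (c x) = g.toAlgHom (z x))

@[simp]
theorem homLift_incl (b : B) : (homLift (hδ := hδ) (hz := hz) (hdz := hdz) g c hc hdc).toAlgHom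
    ((inclHom hδ B deg z hz hdz).toAlgHom b) = g.toAlgHom b :=
  algLift_incl g.toAlgHom (fun _ _ h => g.map_mem h) c hc b

@[simp]
theorem homLift_cell (x : X) : (homLift (hδ := hδ) (hz := hz) (hdz := hdz) g c hc hdc).toAlgHom
    (cell hδ B deg z hz hdz x) = c x :=
  algLift_cell g.toAlgHom (fun _ _ h => g.map_mem h) c hc x

end homLift

theorem cofibrations_inclHom : cofibrations R δ (inclHom hδ B deg z hz hdz) := by
  rintro C D p ⟨hp, hq⟩
  refine ⟨fun {g h} sq => ?_⟩
  have hsq : ∀ b, p.toAlgHom (g.toAlgHom b) =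
      h.toAlgHom ((inclHom hδ B deg z hz hdz).toAlgHom b) := fun b => by
    rw [← comp_apply, sq.w, comp_apply]
  have hx : ∀ x, ∃ c ∈ C.grading (deg x), C.d c = g.toAlgHom (z x) ∧
      p.toAlgHom c = h.toAlgHom (cell hδ B deg z hz hdz x) := fun x =>
    exists_lift_of_acyclicFibration p hp hq (g.map_mem (hz x))
      (by rw [← g.map_d, hdz, map_zero]) (h.map_mem (cell_mem hδ B deg z hz hdz x))
      (by rw [hsq, ← d_cell, h.map_d])
  choose c hc hdc hpc using hx
  refine ⟨⟨⟨homLift g c hc hdc, hom_ext fun b => ?_, Hom.ext (algHom_ext (fun b => ?_)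
    fun x => ?_)⟩⟩⟩
  · rw [comp_apply, homLift_incl]
  · exact (congrArg p.toAlgHom (homLift_incl g c hc hdc b)).trans (hsq b)
  · exact (congrArg p.toAlgHom (homLift_cell g c hc hdc x)).trans (hpc x)

end adjoinCells

end adjoinCells

attribute [irreducible] adjoinCells

end CDGA

namespace CDGA

variable {R : Type u} [CommRing R] {δ : ℤ}

/-! ### Sequential colimits -/

section SeqColimit

variable (F : ℕ ⥤ CDGA R δ)

/-- The transition maps of a sequence. -/
def transition (i j : ℕ) (h : i ≤ j) : F.obj i →ₐ[R] F.obj j := (F.map (homOfLE h)).toAlgHom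

instance : DirectedSystem (fun i => (F.obj i).carrier) (transition F · · ·) where
  map_self i x := by
    change (F.map (𝟙 i)).toAlgHom x = x
    rw [F.map_id, id_apply]
  map_map i j k hij hjk x := by
    change (F.map (homOfLE hjk)).toAlgHom ((F.map (homOfLE hij)).toAlgHom x) = _
    rw [← comp_apply, ← F.map_comp]
    rfl

/-- The underlying algebra of the colimit of a sequence of cdg-algebras. -/
abbrev SeqColimit : Type u := DirectLimit (fun i => (F.obj i).carrier) (transition F)

namespace SeqColimit

/-- The structure maps of the colimit. -/
noncomputable def of (i : ℕ) : F.obj i →ₐ[R] SeqColimit F :=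
  DirectLimit.Algebra.of (fun i => (F.obj i).carrier) (transition F) i

variable {F}

theorem of_map {i j : ℕ} (h : i ≤ j) (a : F.obj i) :
    of F j ((F.map (homOfLE h)).toAlgHom a) = of F i a :=
  DirectLimit.Algebra.of_f (f := transition F) h a

theorem exists_of (a : SeqColimit F) : ∃ i b, of F i b = a := by
  obtain ⟨i, b, rfl⟩ := DirectLimit.exists_eq_mk _ a
  exact ⟨i, b, rfl⟩

theorem of_eq_zero {i : ℕ} {a : F.obj i} (h : of F i a = 0) :
    ∃ j, ∃ hij : i ≤ j, (F.map (homOfLE hij)).toAlgHom a = 0 :=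
  (DirectLimit.exists_eq_zero (f := transition F) (⟨i, a⟩ : Σ i, (F.obj i).carrier)).1 h

/-- A compatible family of linear maps on the terms of the sequence. -/
noncomputable def lift {M : Type*} [AddCommGroup M] [Module R M] (g : ∀ i, F.obj i →ₗ[R] M)
    (hg : ∀ i j (h : i ≤ j) a, g j ((F.map (homOfLE h)).toAlgHom a) = g i a) :
    SeqColimit F →ₗ[R] M :=
  DirectLimit.Module.lift R ℕ (fun i => (F.obj i).carrier) (transition F) g hg

variable (F) in
/-- The images of the homogeneous elements of degree `n`. -/
noncomputable def grading (n : ℤ) : Submodule R (SeqColimit F) where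
  carrier := {a | ∃ i, ∃ b ∈ (F.obj i).grading n, of F i b = a}
  zero_mem' := ⟨0, 0, Submodule.zero_mem _, map_zero _⟩
  smul_mem' := by
    rintro r _ ⟨i, b, hb, rfl⟩
    exact ⟨i, r • b, Submodule.smul_mem _ r hb, map_smul _ _ _⟩
  add_mem' := by
    rintro _ _ ⟨i, a, ha, rfl⟩ ⟨j, b, hb, rfl⟩
    refine ⟨max i j, (F.map (homOfLE (le_max_left i j))).toAlgHom a +
      (F.map (homOfLE (le_max_right i j))).toAlgHom b,
      Submodule.add_mem _ (Hom.map_mem _ ha) (Hom.map_mem _ hb), ?_⟩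
    rw [map_add, of_map, of_map]

theorem of_mem {i : ℕ} {n : ℤ} {a : F.obj i} (ha : a ∈ (F.obj i).grading n) :
    of F i a ∈ grading F n := ⟨i, a, ha, rfl⟩

variable (F) in
/-- The homogeneous components. -/
noncomputable def component (n : ℤ) : SeqColimit F →ₗ[R] SeqColimit F :=
  lift (fun i => (of F i).toLinearMap ∘ₗ (F.obj i).proj n) (fun i j h a => by
    rw [LinearMap.comp_apply, ← hom_proj, AlgHom.toLinearMap_apply, of_map]
    rfl)

variable (F) in
/-- The differential of the colimit. -/
noncomputable def diff : SeqColimit F →ₗ[R] SeqColimit F :=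
  lift (fun i => (of F i).toLinearMap ∘ₗ (F.obj i).d) (fun i j h a => by
    rw [LinearMap.comp_apply, ← Hom.map_d, AlgHom.toLinearMap_apply, of_map]
    rfl)

theorem diff_of {i : ℕ} (a : F.obj i) : diff F (of F i a) = of F i ((F.obj i).d a) := rfl

theorem isInternal : DirectSum.IsInternal (grading F) := by
  refine DirectSum.isInternal_of_projections _ (fun n => (component F n).toAddMonoidHom) ?_ ?_ ?_
  · rintro n _ ⟨i, a, ha, rfl⟩
    change of F i ((F.obj i).proj n a) = _
    rw [proj_same ha]
  · rintro m n hmn _ ⟨i, a, ha, rfl⟩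
    change of F i ((F.obj i).proj n a) = _
    rw [proj_ne ha hmn, map_zero]
  · rw [eq_top_iff]
    intro a _
    obtain ⟨i, a, rfl⟩ := exists_of a
    induction a using homogeneous_induction with
    | h n a ha => exact Submodule.mem_iSup_of_mem n (of_mem ha)
    | hadd a b ha hb => rw [map_add]; exact Submodule.add_mem _ (ha trivial) (hb trivial)

/-- Two elements of the colimit of given degrees come from the same term of the sequence. -/
theorem exists_common {m n : ℤ} {a b : SeqColimit F} (ha : a ∈ grading F m)
    (hb : b ∈ grading F n) : ∃ i, ∃ a' ∈ (F.obj i).grading m, ∃ b' ∈ (F.obj i).grading n,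
      of F i a' = a ∧ of F i b' = b := by
  obtain ⟨i, a, ha, rfl⟩ := ha
  obtain ⟨j, b, hb, rfl⟩ := hb
  exact ⟨max i j, (F.map (homOfLE (le_max_left i j))).toAlgHom a, Hom.map_mem _ ha,
    (F.map (homOfLE (le_max_right i j))).toAlgHom b, Hom.map_mem _ hb, of_map _ _, of_map _ _⟩

end SeqColimit

open SeqColimit

/-- The colimit of a sequence of cdg-algebras. -/
noncomputable def seqColimit : CDGA R δ where
  carrier := SeqColimit F
  grading := SeqColimit.grading F
  isInternal := SeqColimit.isInternal
  one_mem := ⟨0, 1, (F.obj 0).one_mem, map_one _⟩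
  mul_mem ha hb := by
    obtain ⟨i, a, ha', b, hb', rfl, rfl⟩ := exists_common ha hb
    rw [← map_mul]
    exact of_mem ((F.obj i).mul_mem ha' hb')
  graded_comm ha hb := by
    obtain ⟨i, a, ha', b, hb', rfl, rfl⟩ := exists_common ha hb
    rw [← map_mul, (F.obj i).graded_comm ha' hb', map_negOnePow_smul, map_mul]
  d := diff F
  d_mem := by
    rintro n _ ⟨i, a, ha, rfl⟩
    exact of_mem ((F.obj i).d_mem ha)
  d_d a := by
    obtain ⟨i, a, rfl⟩ := exists_of a
    rw [diff_of, diff_of, d_d, map_zero]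
  leibniz {m a} b ha := by
    obtain ⟨j, b, rfl⟩ := exists_of b
    induction b using homogeneous_induction with
    | h n b hb =>
      obtain ⟨i, a, ha', b', -, rfl, h⟩ := exists_common ha (of_mem hb)
      rw [← h, ← map_mul, diff_of, diff_of, diff_of, (F.obj i).leibniz b' ha', map_add,
        map_negOnePow_smul, map_mul, map_mul]
    | hadd b b' hb hb' => simp only [map_add, mul_add, hb, hb', smul_add]; abel

namespace seqColimit

variable {F}

/-- The structure maps of the colimit. -/
noncomputable def ι (i : ℕ) : F.obj i ⟶ seqColimit F where
  toAlgHom := SeqColimit.of F i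
  map_mem ha := SeqColimit.of_mem ha
  map_d _ := rfl

theorem ι_map {i j : ℕ} (h : i ≤ j) (a : F.obj i) :
    (ι j).toAlgHom ((F.map (homOfLE h)).toAlgHom a) = (ι (F := F) i).toAlgHom a :=
  of_map h a

theorem exists_ι (a : seqColimit F) : ∃ i b, (ι (F := F) i).toAlgHom b = a := exists_of a

theorem exists_ι_of_mem {n : ℤ} {a : seqColimit F} (ha : a ∈ (seqColimit F).grading n) :
    ∃ i, ∃ b ∈ (F.obj i).grading n, (ι (F := F) i).toAlgHom b = a := ha

theorem ι_eq_zero {i : ℕ} {a : F.obj i} (h : (ι (F := F) i).toAlgHom a = 0) :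
    ∃ j, ∃ hij : i ≤ j, (F.map (homOfLE hij)).toAlgHom a = 0 :=
  of_eq_zero h

/-- A homogeneous cycle of the colimit is represented by a cycle. -/
theorem exists_cycle {n : ℤ} {z : seqColimit F} (hz : z ∈ (seqColimit F).grading n)
    (hdz : (seqColimit F).d z = 0) : ∃ i, ∃ b ∈ (F.obj i).grading n, (F.obj i).d b = 0 ∧
      (ι (F := F) i).toAlgHom b = z := by
  obtain ⟨i, b, hb, rfl⟩ := exists_ι_of_mem hz
  rw [← Hom.map_d] at hdz
  obtain ⟨j, hij, h⟩ := ι_eq_zero hdz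
  exact ⟨j, (F.map (homOfLE hij)).toAlgHom b, Hom.map_mem _ hb, by rw [← Hom.map_d, h],
    ι_map hij b⟩

variable (F)

/-- The colimit cocone. -/
noncomputable def cocone : Limits.Cocone F where
  pt := seqColimit F
  ι :=
    { app := ι
      naturality := fun _ _ f => hom_ext fun a => ι_map (leOfHom f) a }

variable {F}

/-- The universal property of the underlying graded algebra of the colimit. -/
noncomputable def algLift {C : Type*} [Ring C] [Algebra R C] (g : ∀ i, F.obj i →ₐ[R] C)
    (hg : ∀ i j (h : i ≤ j) a, g j ((F.map (homOfLE h)).toAlgHom a) = g i a) :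
    seqColimit F →ₐ[R] C :=
  DirectLimit.Algebra.lift (fun i => (F.obj i).carrier) (transition F) C g hg

theorem cocone_w (c : Limits.Cocone F) (i j : ℕ) (h : i ≤ j) (a : F.obj i) :
    (c.ι.app j).toAlgHom ((F.map (homOfLE h)).toAlgHom a) = (c.ι.app i).toAlgHom a := by
  rw [← comp_apply, c.w]

variable (F) in
/-- The colimit cocone is universal. -/
noncomputable def isColimit : Limits.IsColimit (cocone F) where
  desc c :=
    { toAlgHom := algLift (fun i => (c.ι.app i).toAlgHom) (cocone_w c)
      map_mem := by
        rintro n _ ⟨i, a, ha, rfl⟩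
        exact (c.ι.app i).map_mem ha
      map_d := fun a => by
        obtain ⟨i, a, rfl⟩ := exists_ι a
        exact (c.ι.app i).map_d a }
  fac c i := rfl
  uniq c m hm := hom_ext fun a => by
    obtain ⟨i, a, rfl⟩ := exists_ι a
    exact congrArg (fun f : F.obj i ⟶ c.pt => f.toAlgHom a) (hm i)

end seqColimit

end SeqColimit

/-- The structure map from the first term into the colimit of a sequence of cofibrations is a
cofibration. -/
theorem cofibrations_ι_zero (F : ℕ ⥤ CDGA R δ)
    (hF : ∀ i : ℕ, cofibrations R δ (F.map (homOfLE (Nat.le_succ i)))) :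
    cofibrations R δ (seqColimit.ι (F := F) 0) := fun _ _ p hp =>
  HasLiftingProperty.transfiniteComposition.hasLiftingProperty_ι_app_bot
    (hc := seqColimit.isColimit F) (fun j _ => hF j p hp)

end CDGA

namespace CDGA

variable {R : Type u} [CommRing R] {δ : ℤ}

/-! ### Iterated attachment of cells -/

/-- The cells of degree `n` that can be attached to `B` over `f : B ⟶ A`: a cycle `z` of `B`
together with a primitive `a` of its image in `A`. -/
def cellSubmodule {A B : CDGA R δ} (f : B ⟶ A) (n : ℤ) : Submodule R (B × A) where
  carrier := {p | p.1 ∈ B.grading (n + δ) ∧ B.d p.1 = 0 ∧ p.2 ∈ A.grading n ∧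
    f.toAlgHom p.1 = A.d p.2}
  zero_mem' := ⟨Submodule.zero_mem _, map_zero _, Submodule.zero_mem _,
    (map_zero _).trans (map_zero _).symm⟩
  add_mem' := by
    rintro p q ⟨h₁, h₂, h₃, h₄⟩ ⟨h₁', h₂', h₃', h₄'⟩
    refine ⟨Submodule.add_mem _ h₁ h₁', ?_, Submodule.add_mem _ h₃ h₃', ?_⟩
    · rw [Prod.fst_add, map_add, h₂, h₂', add_zero]
    · rw [Prod.fst_add, Prod.snd_add, map_add, map_add, h₄, h₄']
  smul_mem' := by
    rintro r p ⟨h₁, h₂, h₃, h₄⟩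
    refine ⟨Submodule.smul_mem _ r h₁, ?_, Submodule.smul_mem _ r h₃, ?_⟩
    · rw [Prod.smul_fst, map_smul, h₂, smul_zero]
    · rw [Prod.smul_fst, Prod.smul_snd, map_smul, map_smul, h₄]

/-- The cells whose attachment adds nothing up to homotopy. The quotient of `cellSubmodule f n` by
this submodule is the relative homology of `f`. -/
def trivialCells {A B : CDGA R δ} (f : B ⟶ A) (n : ℤ) : Submodule R (B × A) where
  carrier := {p | ∃ b ∈ B.grading n, ∃ a ∈ A.grading (n - δ),
    p = (B.d b, f.toAlgHom b + A.d a)}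
  zero_mem' := ⟨0, Submodule.zero_mem _, 0, Submodule.zero_mem _, by simp; rfl⟩
  add_mem' := by
    rintro _ _ ⟨b, hb, a, ha, rfl⟩ ⟨b', hb', a', ha', rfl⟩
    exact ⟨b + b', Submodule.add_mem _ hb hb', a + a', Submodule.add_mem _ ha ha', by
      rw [map_add, map_add, map_add, Prod.mk_add_mk, add_add_add_comm]⟩
  smul_mem' := by
    rintro r _ ⟨b, hb, a, ha, rfl⟩
    exact ⟨r • b, Submodule.smul_mem _ r hb, r • a, Submodule.smul_mem _ r ha, by
      rw [map_smul, map_smul, map_smul, Prod.smul_mk, smul_add]⟩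

theorem trivialCells_le {A B : CDGA R δ} (f : B ⟶ A) (n : ℤ) :
    trivialCells f n ≤ cellSubmodule f n := by
  rintro _ ⟨b, hb, a, ha, rfl⟩
  refine ⟨B.d_mem hb, B.d_d b, Submodule.add_mem _ (f.map_mem hb) ?_, ?_⟩
  · simpa using A.d_mem ha
  · rw [map_add, A.d_d, add_zero, f.map_d]

/-- A choice, for every map to `A`, of a set of cells to be attached. -/
structure CellSystem (A : CDGA R δ) where
  /-- the chosen cells of a given degree -/
  cells : ∀ {B : CDGA R δ} (_ : B ⟶ A), ℤ → Set (B × A)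
  cells_subset : ∀ {B : CDGA R δ} (f : B ⟶ A) (n : ℤ), cells f n ⊆ cellSubmodule f n

namespace CellSystem

variable {A : CDGA R δ} (S : CellSystem A) (hδ : Odd δ)

section attach

variable {B : CDGA R δ} (f : B ⟶ A)

/-- The index type of the chosen cells of all degrees. -/
abbrev Index : Type u := Σ n : ℤ, S.cells f n

/-- The cdg-algebra obtained from `B` by attaching the chosen cells. -/
noncomputable def attach : CDGA R δ :=
  adjoinCells hδ B (X := S.Index f) (fun x => x.1) (fun x => x.2.1.1)
    (fun x => (S.cells_subset f _ x.2.2).1) (fun x => (S.cells_subset f _ x.2.2).2.1)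

/-- The inclusion of the base. -/
noncomputable def incl : B ⟶ S.attach hδ f := adjoinCells.inclHom ..

/-- The generator that belongs to a cell. -/
noncomputable def cell (x : S.Index f) : S.attach hδ f := adjoinCells.cell _ _ _ _ _ _ x

/-- The extension of `f` over the attached cells. -/
noncomputable def desc : S.attach hδ f ⟶ A :=
  adjoinCells.homLift f (fun x => x.2.1.2) (fun x => (S.cells_subset f _ x.2.2).2.2.1)
    (fun x => (S.cells_subset f _ x.2.2).2.2.2.symm)

@[simp]
theorem desc_incl (b : B) : (S.desc hδ f).toAlgHom ((S.incl hδ f).toAlgHom b) = f.toAlgHom b :=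
  adjoinCells.homLift_incl ..

@[simp]
theorem desc_cell (x : S.Index f) : (S.desc hδ f).toAlgHom (S.cell hδ f x) = x.2.1.2 :=
  adjoinCells.homLift_cell ..

theorem cell_mem (x : S.Index f) : S.cell hδ f x ∈ (S.attach hδ f).grading x.1 :=
  adjoinCells.cell_mem _ _ _ _ _ _ x

theorem d_cell (x : S.Index f) :
    (S.attach hδ f).d (S.cell hδ f x) = (S.incl hδ f).toAlgHom x.2.1.1 :=
  adjoinCells.d_cell _ _ _ _ _ _ x

section attachLift

variable {C : CDGA R δ} (g : B →ₐ[R] C) (hg : ∀ n, ∀ b ∈ B.grading n, g b ∈ C.grading n)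
  (c : S.Index f → C) (hc : ∀ x, c x ∈ C.grading x.1)

/-- The universal property of the underlying graded algebra. -/
noncomputable def attachLift : S.attach hδ f →ₐ[R] C := adjoinCells.algLift _ _ _ _ g hg c hc

@[simp]
theorem attachLift_incl (b : B) :
    S.attachLift hδ f g hg c hc ((S.incl hδ f).toAlgHom b) = g b :=
  adjoinCells.algLift_incl ..

@[simp]
theorem attachLift_cell (x : S.Index f) :
    S.attachLift hδ f g hg c hc (S.cell hδ f x) = c x :=
  adjoinCells.algLift_cell ..

theorem attachLift_mem {n : ℤ} {a : S.attach hδ f} (ha : a ∈ (S.attach hδ f).grading n) :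
    S.attachLift hδ f g hg c hc a ∈ C.grading n :=
  adjoinCells.algLift_mem _ _ _ _ ha

end attachLift

theorem incl_injective : Function.Injective (S.incl hδ f).toAlgHom :=
  adjoinCells.inclHom_injective

theorem adjoin_eq_top : Algebra.adjoin R
    (Set.range (S.incl hδ f).toAlgHom ∪ Set.range (S.cell hδ f)) = ⊤ :=
  adjoinCells.adjoin_eq_top ..

theorem cofibrations_incl : cofibrations R δ (S.incl hδ f) := adjoinCells.cofibrations_inclHom

/-- The cells spanned by the chosen ones and the trivial ones are filled after one step. -/
theorem exists_fill {n : ℤ} {p : B × A}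
    (hp : p ∈ Submodule.span R (S.cells f n) ⊔ trivialCells f n) :
    ∃ u ∈ (S.attach hδ f).grading n, (S.attach hδ f).d u = (S.incl hδ f).toAlgHom p.1 ∧
      ∃ a ∈ A.grading (n - δ), (S.desc hδ f).toAlgHom u = p.2 + A.d a := by
  obtain ⟨q, hq, t, ⟨b, hb, a, ha, rfl⟩, rfl⟩ := Submodule.mem_sup.1 hp
  have hq' : ∃ u ∈ (S.attach hδ f).grading n, (S.attach hδ f).d u = (S.incl hδ f).toAlgHom q.1 ∧
      (S.desc hδ f).toAlgHom u = q.2 := by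
    clear hp
    induction hq using Submodule.span_induction with
    | mem q hq => 
      exact ⟨S.cell hδ f ⟨n, q, hq⟩, S.cell_mem hδ f ⟨n, q, hq⟩, S.d_cell hδ f ⟨n, q, hq⟩,
        S.desc_cell hδ f ⟨n, q, hq⟩⟩
    | zero => exact ⟨0, Submodule.zero_mem _, by simp, by simp⟩
    | add q q' _ _ h h' =>
      obtain ⟨u, hu, hdu, hfu⟩ := h
      obtain ⟨u', hu', hdu', hfu'⟩ := h'
      exact ⟨u + u', Submodule.add_mem _ hu hu', by simp [hdu, hdu'], by simp [hfu, hfu']⟩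
    | smul r q _ h =>
      obtain ⟨u, hu, hdu, hfu⟩ := h
      exact ⟨r • u, Submodule.smul_mem _ r hu, by simp [hdu], by simp [hfu]⟩
  obtain ⟨u, hu, hdu, hfu⟩ := hq'
  refine ⟨u + (S.incl hδ f).toAlgHom b, Submodule.add_mem _ hu (Hom.map_mem _ hb), ?_, -a,
    Submodule.neg_mem _ ha, ?_⟩
  · rw [map_add, hdu, ← Hom.map_d, Prod.fst_add, map_add]
  · rw [map_add, hfu, desc_incl, map_neg]
    change q.2 + f.toAlgHom b = q.2 + (f.toAlgHom b + A.d a) + -A.d a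
    abel

end attach

variable {B : CDGA R δ} (f : B ⟶ A)

/-- The stages of the iterated attachment of the chosen cells, with their maps to `A`. -/
noncomputable def stage : ℕ → Σ M : CDGA R δ, M ⟶ A
  | 0 => ⟨B, f⟩
  | j + 1 => ⟨S.attach hδ (stage j).2, S.desc hδ (stage j).2⟩

/-- The sequence of stages. -/
noncomputable def stages : ℕ ⥤ CDGA R δ :=
  Functor.ofSequence (X := fun j => (S.stage hδ f j).1) fun j => S.incl hδ (S.stage hδ f j).2

theorem stages_map_succ (j : ℕ) :
    (S.stages hδ f).map (homOfLE (Nat.le_succ j)) = S.incl hδ (S.stage hδ f j).2 :=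
  Functor.ofSequence_map_homOfLE_succ _ j

/-- The map from a stage to `A`. -/
noncomputable def stageMap (j : ℕ) : (S.stages hδ f).obj j ⟶ A := (S.stage hδ f j).2

/-- The maps from the stages to `A`, as a cocone. -/
noncomputable def stagesCocone : Limits.Cocone (S.stages hδ f) where
  pt := A
  ι := NatTrans.ofSequence (S.stageMap hδ f) fun j => hom_ext fun a => by
    refine Eq.trans ?_ (S.desc_incl hδ (S.stage hδ f j).2 a)
    exact congrArg (fun g : (S.stages hδ f).obj j ⟶ (S.stages hδ f).obj (j + 1) =>
      (S.stageMap hδ f (j + 1)).toAlgHom (g.toAlgHom a)) (S.stages_map_succ hδ f j)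

/-- The cdg-algebra obtained from `B` by attaching the chosen cells infinitely often. -/
noncomputable def model : CDGA R δ := seqColimit (S.stages hδ f)

/-- The map from a stage to the model. -/
noncomputable def ι (j : ℕ) : (S.stages hδ f).obj j ⟶ S.model hδ f := seqColimit.ι j

/-- The map from the model to `A`. -/
noncomputable def modelMap : S.model hδ f ⟶ A :=
  (seqColimit.isColimit (S.stages hδ f)).desc (S.stagesCocone hδ f)

/-- The inclusion of `B` into the model. -/
noncomputable def modelIncl : B ⟶ S.model hδ f := S.ι hδ f 0

theorem modelIncl_modelMap : S.modelIncl hδ f ≫ S.modelMap hδ f = f := rfl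

theorem cofibrations_modelIncl : cofibrations R δ (S.modelIncl hδ f) :=
  cofibrations_ι_zero (S.stages hδ f) fun j => by
    rw [stages_map_succ]
    exact S.cofibrations_incl hδ _

/-- The map from a stage to the model, for a stage that is seen as obtained from the previous one by
attaching cells. -/
noncomputable def ιSucc (j : ℕ) : S.attach hδ (S.stageMap hδ f j) ⟶ S.model hδ f := S.ι hδ f (j + 1)

theorem ιSucc_incl (j : ℕ) (a : (S.stages hδ f).obj j) :
    (S.ιSucc hδ f j).toAlgHom ((S.incl hδ (S.stageMap hδ f j)).toAlgHom a) =
      (S.ι hδ f j).toAlgHom a := by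
  refine Eq.trans ?_ (seqColimit.ι_map (F := S.stages hδ f) (Nat.le_succ j) a)
  rw [stages_map_succ]
  rfl

/-- A map out of the model that is compatible with the attachment of cells in every stage. -/
noncomputable def modelLift {C : Type*} [Ring C] [Algebra R C]
    (g : ∀ j, (S.stages hδ f).obj j →ₐ[R] C) (hg : ∀ j a,
      g (j + 1) (((S.stages hδ f).map (homOfLE (Nat.le_succ j))).toAlgHom a) = g j a) :
    S.model hδ f →ₐ[R] C :=
  seqColimit.algLift g fun i j hij => by
    induction j, hij using Nat.le_induction with
    | base => intro a; exact congrArg (fun h => g i (Hom.toAlgHom h a)) ((S.stages hδ f).map_id i)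
    | succ j hij ih =>
      intro a
      rw [← ih a, ← hg j, ← comp_apply, ← Functor.map_comp]
      rfl

theorem exists_ι (a : S.model hδ f) : ∃ j b, (S.ι hδ f j).toAlgHom b = a :=
  seqColimit.exists_ι a

theorem exists_ι_cycle {n : ℤ} {z : S.model hδ f} (hz : z ∈ (S.model hδ f).grading n)
    (hdz : (S.model hδ f).d z = 0) : ∃ j, ∃ b ∈ ((S.stages hδ f).obj j).grading n,
      ((S.stages hδ f).obj j).d b = 0 ∧ (S.ι hδ f j).toAlgHom b = z :=
  seqColimit.exists_cycle hz hdz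

/-- If in every stage the chosen cells generate the relative homology in degree `n`, all cells of
degree `n` of the model are filled. -/
theorem fillsCells_modelMap {n : ℤ} (h : ∀ {B : CDGA R δ} (f : B ⟶ A),
    cellSubmodule f n ≤ Submodule.span R (S.cells f n) ⊔ trivialCells f n) :
    FillsCells (S.modelMap hδ f) n := by
  intro z hz hdz a ha hfz
  obtain ⟨j, b, hb, hdb, rfl⟩ := S.exists_ι_cycle hδ f hz hdz
  obtain ⟨u, hu, hdu, a', ha', hfu⟩ := S.exists_fill hδ (S.stageMap hδ f j)
    (p := (b, a)) (h _ ⟨hb, hdb, ha, hfz⟩)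
  refine ⟨(S.ιSucc hδ f j).toAlgHom u, Hom.map_mem _ hu, ?_, a', ha', hfu⟩
  rw [← Hom.map_d, hdu, ιSucc_incl]

end CellSystem

/-! ### Cofibrant replacements of sequences -/

/-- The choice of all cells. -/
def allCells (A : CDGA R δ) : CellSystem A where
  cells f n := cellSubmodule f n
  cells_subset _ _ := le_rfl

theorem isQuasiIso_modelMap_allCells (hδ : Odd δ) {A B : CDGA R δ} (f : B ⟶ A) :
    IsQuasiIso ((allCells A).modelMap hδ f) :=
  isQuasiIso_of_fillsCells _ fun _ => (allCells A).fillsCells_modelMap hδ f fun _ _ hp =>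
    Submodule.mem_sup_left (Submodule.subset_span hp)

section cofibrantReplacement

variable (hδ : Odd δ) (A : ℕ ⥤ CDGA R δ)

/-- The terms of a cofibrant replacement of a sequence, with their maps to the sequence. -/
noncomputable def replacement : ∀ i : ℕ, Σ E : CDGA R δ, E ⟶ A.obj i
  | 0 => ⟨(allCells (A.obj 0)).model hδ (unit (A.obj 0)), (allCells (A.obj 0)).modelMap hδ _⟩
  | i + 1 => ⟨(allCells (A.obj (i + 1))).model hδ
      ((replacement i).2 ≫ A.map (homOfLE (Nat.le_succ i))), (allCells _).modelMap hδ _⟩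

/-- The maps of the cofibrant replacement. -/
noncomputable def replacementMap (i : ℕ) : (replacement hδ A i).1 ⟶ (replacement hδ A (i + 1)).1 :=
  (allCells (A.obj (i + 1))).modelIncl hδ _

/-- Every sequence of cdg-algebras has a cofibrant replacement. -/
theorem exists_isCofibrantSequence (hδ : Odd δ) (A : ℕ ⥤ CDGA R δ) :
    ∃ (E : ℕ ⥤ CDGA R δ) (w : E ⟶ A),
    IsCofibrantSequence E ∧ ∀ i, IsQuasiIso (w.app i) := by
  have hmap (i : ℕ) : (Functor.ofSequence (replacementMap hδ A)).map (homOfLE (Nat.le_succ i)) =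
      replacementMap hδ A i := Functor.ofSequence_map_homOfLE_succ _ i
  refine ⟨Functor.ofSequence (replacementMap hδ A),
    NatTrans.ofSequence (fun i => (replacement hδ A i).2) fun i => ?_,
    ⟨?_, fun i => ?_⟩, fun i => ?_⟩
  · rw [Functor.ofSequence_map_homOfLE_succ]
    exact (allCells (A.obj (i + 1))).modelIncl_modelMap hδ _
  · have h := (allCells (A.obj 0)).cofibrations_modelIncl hδ (unit (A.obj 0))
    have e : unit ((allCells (A.obj 0)).model hδ (unit (A.obj 0))) =
        (allCells (A.obj 0)).modelIncl hδ (unit (A.obj 0)) :=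
      hom_ext fun r => (AlgHom.commutes (Hom.toAlgHom ((allCells (A.obj 0)).modelIncl hδ _)) r).symm
    rw [← e] at h
    exact h
  · rw [hmap]
    exact (allCells _).cofibrations_modelIncl hδ _
  · cases i with
    | zero => exact isQuasiIso_modelMap_allCells hδ _
    | succ i => exact isQuasiIso_modelMap_allCells hδ _

theorem exists_isHocolim (hδ : Odd δ) (A : ℕ ⥤ CDGA R δ) : ∃ H, IsHocolim A H := by
  obtain ⟨E, w, hE, hw⟩ := exists_isCofibrantSequence hδ A
  exact ⟨_, E, w, hE, hw, seqColimit.cocone E, ⟨seqColimit.isColimit E⟩, rfl⟩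

end cofibrantReplacement

end CDGA

namespace CDGA

variable {R : Type u} [CommRing R] {δ : ℤ}

/-! ### Low degrees of positively generated algebras -/

/-- Products of two or more generators of degree larger than `k` have degree larger than `k + 1`. -/
theorem span_generators_eq_top {A : CDGA R δ} {k : ℕ} {T : Set A}
    (hT : ∀ t ∈ T, ∃ m : ℤ, k < m ∧ t ∈ A.grading m) (hA : Algebra.adjoin R T = ⊤) :
    Submodule.span R ({1} ∪ T ∪ {a | ∃ m : ℤ, k + 1 < m ∧ a ∈ A.grading m}) = ⊤ := by
  rw [eq_top_iff, ← Algebra.top_toSubmodule, ← hA, Algebra.adjoin_eq_span]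
  refine Submodule.span_mono fun a ha => ?_
  induction ha using Submonoid.closure_induction with
  | mem a ha => exact Or.inl (Or.inr ha)
  | one => exact Or.inl (Or.inl rfl)
  | mul a b _ _ ha hb =>
    have hdeg : ∀ x, x ∈ T ∪ {a | ∃ m : ℤ, k + 1 < m ∧ a ∈ A.grading m} →
        ∃ m : ℤ, k < m ∧ x ∈ A.grading m := by
      rintro x (hx | ⟨m, hm, hx⟩)
      · exact hT x hx
      · exact ⟨m, by omega, hx⟩
    rw [Set.union_assoc] at ha hb ⊢
    rcases ha with rfl | ha
    · rwa [one_mul]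
    rcases hb with rfl | hb
    · rw [mul_one]; exact Or.inr ha
    obtain ⟨m, hm, ham⟩ := hdeg a ha
    obtain ⟨n, hn, hbn⟩ := hdeg b hb
    exact Or.inr (Or.inr ⟨m + n, by omega, A.mul_mem ham hbn⟩)

theorem mem_span_generators_of_mem {A : CDGA R δ} {k : ℕ} {T : Set A}
    (hT : ∀ t ∈ T, ∃ m : ℤ, k < m ∧ t ∈ A.grading m) (hA : Algebra.adjoin R T = ⊤)
    {n : ℤ} (hn : n ≤ k + 1) (hn₀ : n ≠ 0) {a : A}
    (ha : a ∈ A.grading n) : a ∈ Submodule.span R (T ∩ A.grading n) := by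
  suffices h : Submodule.span R ({1} ∪ T ∪ {a | ∃ m : ℤ, k + 1 < m ∧ a ∈ A.grading m}) ≤
      (Submodule.span R (T ∩ A.grading n)).comap (A.proj n) by
    rw [span_generators_eq_top hT hA] at h
    have := h (Submodule.mem_top (x := a))
    rwa [Submodule.mem_comap, proj_same ha] at this
  rw [Submodule.span_le]
  rintro x ((rfl | hx) | ⟨m, hm, hx⟩)
  · rw [SetLike.mem_coe, Submodule.mem_comap, proj_ne A.one_mem hn₀.symm]
    exact Submodule.zero_mem _
  · obtain ⟨m, -, hxm⟩ := hT x hx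
    rw [SetLike.mem_coe, Submodule.mem_comap]
    by_cases hmn : m = n
    · subst hmn
      rw [proj_same hxm]
      exact Submodule.subset_span ⟨hx, hxm⟩
    · rw [proj_ne hxm hmn]
      exact Submodule.zero_mem _
  · rw [SetLike.mem_coe, Submodule.mem_comap, proj_ne hx (by omega)]
    exact Submodule.zero_mem _

theorem IsPosGenerated.eq_zero_of_mem {A : CDGA R δ} {k : ℕ} (hA : A.IsPosGenerated k) {n : ℤ}
    (hn : n ≤ k) (hn₀ : n ≠ 0) {a : A} (ha : a ∈ A.grading n) : a = 0 := by
  have h := mem_span_generators_of_mem (fun _ h => h) hA (by omega) hn₀ ha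
  suffices hle : Submodule.span R
      ({a : A | ∃ n : ℤ, (k : ℤ) < n ∧ a ∈ A.grading n} ∩ A.grading n) ≤ ⊥ from hle h
  rw [Submodule.span_le]
  rintro x ⟨⟨m, hm, hxm⟩, hxn⟩
  exact (proj_same hxn).symm.trans (proj_ne hxm (by omega))

theorem IsPosGenerated.exists_algebraMap {A : CDGA R δ} {k : ℕ} (hA : A.IsPosGenerated k) {a : A}
    (ha : a ∈ A.grading 0) : ∃ r, algebraMap R A r = a := by
  suffices h : Submodule.span R ({1} ∪ {a : A | ∃ n : ℤ, (k : ℤ) < n ∧ a ∈ A.grading n} ∪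
      {a | ∃ m : ℤ, k + 1 < m ∧ a ∈ A.grading m}) ≤
      (LinearMap.range (Algebra.linearMap R A)).comap (A.proj 0) by
    rw [span_generators_eq_top (T := {a : A | ∃ n : ℤ, (k : ℤ) < n ∧ a ∈ A.grading n})
      (fun _ h => h) hA] at h
    have := h (Submodule.mem_top (x := a))
    rwa [Submodule.mem_comap, proj_same ha] at this
  rw [Submodule.span_le]
  rintro x ((rfl | ⟨m, hm, hx⟩) | ⟨m, hm, hx⟩)
  · rw [SetLike.mem_coe, Submodule.mem_comap, proj_same A.one_mem]
    exact ⟨1, map_one (algebraMap R A)⟩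
  · rw [SetLike.mem_coe, Submodule.mem_comap, proj_ne hx (by omega)]
    exact Submodule.zero_mem _
  · rw [SetLike.mem_coe, Submodule.mem_comap, proj_ne hx (by omega)]
    exact Submodule.zero_mem _

/-- In degrees up to `k` the homology of `A` is that of the coefficient ring: `R → H₀(A)` is
bijective, and `Hₙ(A) = 0` for all `n ≤ k` different from `0`. -/
structure IsHomologyTrivialTo (k : ℕ) (A : CDGA R δ) : Prop where
  exact : ∀ n : ℤ, n ≤ k → n ≠ 0 → ∀ a ∈ A.grading n, A.d a = 0 → ∃ b ∈ A.grading (n - δ), A.d b = a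
  surj : ∀ a ∈ A.grading 0, A.d a = 0 →
    ∃ r : R, ∃ b ∈ A.grading (0 - δ), A.d b = a - algebraMap R A r
  inj : ∀ r : R, ∀ b, A.d b = algebraMap R A r → r = 0

theorem IsPosGenerated.isHomologyTrivialTo {A : CDGA R δ} {k : ℕ} (hA : A.IsPosGenerated k)
    (ε : A.Augmentation) : A.IsHomologyTrivialTo k where
  exact n hn hn₀ a ha _ := ⟨0, Submodule.zero_mem _, by
    rw [map_zero, hA.eq_zero_of_mem hn hn₀ ha]⟩
  surj a ha _ := by
    obtain ⟨r, rfl⟩ := hA.exists_algebraMap ha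
    exact ⟨r, 0, Submodule.zero_mem _, by rw [map_zero, sub_self]⟩
  inj r b h := by
    have h' := ε.map_d b
    rw [h, AlgHom.commutes] at h'
    exact h'

theorem IsHomologyTrivialTo.of_injective {A B : CDGA R δ} {k : ℕ} (hB : B.IsHomologyTrivialTo k)
    (f : A ⟶ B) (hf : Function.Injective (homologyMap f)) : A.IsHomologyTrivialTo k where
  exact n hn hn₀ a ha hda := by
    obtain ⟨b, hb, hdb⟩ := hB.exact n hn hn₀ _ (f.map_mem ha) (by rw [← f.map_d, hda, map_zero])
    exact (homologyMap_injective_iff f).1 hf (n - δ) a (by simpa using ha) hda b hb hdb.symm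
  surj a ha hda := by
    obtain ⟨r, b, hb, hdb⟩ := hB.surj _ (f.map_mem ha) (by rw [← f.map_d, hda, map_zero])
    obtain ⟨c, hc, hdc⟩ := (homologyMap_injective_iff f).1 hf (0 - δ) (a - algebraMap R A r)
      (by simpa using Submodule.sub_mem _ ha (algebraMap_mem r))
      (by rw [map_sub, hda, d_algebraMap, sub_zero]) b hb
      (by rw [map_sub, AlgHom.commutes, hdb])
    exact ⟨r, c, hc, hdc⟩
  inj r b h := hB.inj r (f.toAlgHom b) (by rw [← f.map_d, h, AlgHom.commutes])

theorem isHomologyTrivialTo_seqColimit (F : ℕ ⥤ CDGA R δ) {k : ℕ}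
    (hF : ∀ i, (F.obj i).IsHomologyTrivialTo k) : (seqColimit F).IsHomologyTrivialTo k where
  exact n hn hn₀ a ha hda := by
    obtain ⟨i, a, ha', hda', rfl⟩ := seqColimit.exists_cycle ha hda
    obtain ⟨b, hb, rfl⟩ := (hF i).exact n hn hn₀ a ha' hda'
    exact ⟨(seqColimit.ι i).toAlgHom b, Hom.map_mem _ hb, (Hom.map_d _ _).symm⟩
  surj a ha hda := by
    obtain ⟨i, a, ha', hda', rfl⟩ := seqColimit.exists_cycle ha hda
    obtain ⟨r, b, hb, hdb⟩ := (hF i).surj a ha' hda'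
    exact ⟨r, (seqColimit.ι i).toAlgHom b, Hom.map_mem _ hb, by
      rw [← Hom.map_d, hdb, map_sub, AlgHom.commutes]⟩
  inj r b h := by
    obtain ⟨i, b, rfl⟩ := seqColimit.exists_ι b
    rw [← Hom.map_d, ← (Hom.toAlgHom (seqColimit.ι i)).commutes, ← sub_eq_zero, ← map_sub] at h
    obtain ⟨j, hij, h⟩ := seqColimit.ι_eq_zero h
    rw [map_sub, AlgHom.commutes, Hom.map_d, sub_eq_zero] at h
    exact (hF j).inj r _ h

end CDGA

namespace CDGA

variable {R : Type u} [CommRing R] {δ : ℤ}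

/-! ### Models generated in degrees larger than `k` -/

theorem isPosGenerated_base (k : ℕ) : (base R δ).IsPosGenerated k :=
  Algebra.eq_top_iff.2 fun r => Subalgebra.algebraMap_mem (R := R) (A := (base R δ).carrier) _ r

namespace CellSystem

variable {A : CDGA R δ} (S : CellSystem A) (hδ : Odd δ) {k : ℕ}

/-- The generators of degree larger than `k` of an algebra obtained by attaching cells. -/
def posGenerators (k : ℕ) {B : CDGA R δ} (f : B ⟶ A) : Set (S.attach hδ f) :=
  (S.incl hδ f).toAlgHom '' {b | ∃ n : ℤ, (k : ℤ) < n ∧ b ∈ B.grading n} ∪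
    Set.range (S.cell hδ f)

theorem adjoin_posGenerators {B : CDGA R δ} (f : B ⟶ A) (hB : B.IsPosGenerated k) :
    Algebra.adjoin R (S.posGenerators hδ k f) = ⊤ := by
  rw [eq_top_iff, ← S.adjoin_eq_top hδ f, Algebra.adjoin_le_iff]
  rintro _ (⟨b, rfl⟩ | ⟨x, rfl⟩)
  · have hb : b ∈ (Algebra.adjoin R (S.posGenerators hδ k f)).comap (S.incl hδ f).toAlgHom := by
      refine le_trans (ge_of_eq hB) (Algebra.adjoin_le fun b hb => ?_) (Algebra.mem_top (x := b))
      exact Algebra.subset_adjoin (Or.inl ⟨b, hb, rfl⟩)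
    exact hb
  · exact Algebra.subset_adjoin (Or.inr ⟨x, rfl⟩)

theorem posGenerators_pos (hS : ∀ {B : CDGA R δ} (f : B ⟶ A), ∀ n ≤ (k : ℤ), S.cells f n = ∅)
    {B : CDGA R δ} (f : B ⟶ A) : ∀ t ∈ S.posGenerators hδ k f,
      ∃ m : ℤ, k < m ∧ t ∈ (S.attach hδ f).grading m := by
  rintro _ (⟨b, ⟨n, hn, hb⟩, rfl⟩ | ⟨⟨n, s⟩, rfl⟩)
  · exact ⟨n, hn, Hom.map_mem _ hb⟩
  · refine ⟨n, ?_, S.cell_mem hδ f ⟨n, s⟩⟩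
    by_contra hn
    exact (Set.eq_empty_iff_forall_notMem.1 (hS f n (not_lt.1 hn))) _ s.2

theorem isPosGenerated_stage (hS : ∀ {B : CDGA R δ} (f : B ⟶ A), ∀ n ≤ (k : ℤ), S.cells f n = ∅)
    {B : CDGA R δ} (f : B ⟶ A) (hB : B.IsPosGenerated k) (j : ℕ) :
    ((S.stages hδ f).obj j).IsPosGenerated k := by
  induction j with
  | zero => exact hB
  | succ j ih =>
    change (S.attach hδ (S.stageMap hδ f j)).IsPosGenerated k
    rw [IsPosGenerated, eq_top_iff, ← S.adjoin_posGenerators hδ _ ih]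
    exact Algebra.adjoin_mono (S.posGenerators_pos hδ hS _)

theorem isPosGenerated_model (hS : ∀ {B : CDGA R δ} (f : B ⟶ A), ∀ n ≤ (k : ℤ), S.cells f n = ∅)
    {B : CDGA R δ} (f : B ⟶ A) (hB : B.IsPosGenerated k) : (S.model hδ f).IsPosGenerated k := by
  rw [IsPosGenerated, Algebra.eq_top_iff]
  intro a
  obtain ⟨j, a, rfl⟩ := S.exists_ι hδ f a
  have ha : a ∈ (Algebra.adjoin R {a : S.model hδ f | ∃ n : ℤ, (k : ℤ) < n ∧
      a ∈ (S.model hδ f).grading n}).comap (S.ι hδ f j).toAlgHom := by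
    refine le_trans (ge_of_eq (S.isPosGenerated_stage hδ hS f hB j)) (Algebra.adjoin_le ?_)
      (Algebra.mem_top (x := a))
    rintro b ⟨n, hn, hb⟩
    exact Algebra.subset_adjoin ⟨n, hn, (S.ι hδ f j).map_mem hb⟩
  exact ha

/-- The chosen cells of degree `n` are linearly independent in the relative homology. -/
def IsIndependent (n : ℤ) : Prop :=
  ∀ {B : CDGA R δ} (f : B ⟶ A) (c : S.cells f n →₀ R),
    Finsupp.linearCombination R Subtype.val c ∈ trivialCells f n → c = 0

/-- The combination of generators that belongs to a combination of cells. -/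
noncomputable def combination {B : CDGA R δ} (f : B ⟶ A) (n : ℤ) :
    (S.cells f n →₀ R) →ₗ[R] S.attach hδ f :=
  Finsupp.linearCombination R fun s => S.cell hδ f ⟨n, s⟩

theorem d_combination {B : CDGA R δ} (f : B ⟶ A) (n : ℤ) (c : S.cells f n →₀ R) :
    (S.attach hδ f).d (S.combination hδ f n c) =
      (S.incl hδ f).toAlgHom (Finsupp.linearCombination R Subtype.val c).1 := by
  induction c using Finsupp.induction_linear with
  | zero => simp
  | add c c' h h' => rw [map_add, map_add, h, h', map_add, Prod.fst_add, map_add]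
  | single s r =>
    rw [combination, Finsupp.linearCombination_single, Finsupp.linearCombination_single, map_smul,
      d_cell, Prod.smul_fst, map_smul]

theorem desc_combination {B : CDGA R δ} (f : B ⟶ A) (n : ℤ) (c : S.cells f n →₀ R) :
    (S.desc hδ f).toAlgHom (S.combination hδ f n c) =
      (Finsupp.linearCombination R Subtype.val c).2 := by
  induction c using Finsupp.induction_linear with
  | zero => simp
  | add c c' h h' => rw [map_add, map_add, h, h', map_add, Prod.snd_add]
  | single s r =>
    rw [combination, Finsupp.linearCombination_single, Finsupp.linearCombination_single, map_smul,
      desc_cell, Prod.smul_snd]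

/-- In degree `k + 1` an algebra obtained by attaching cells consists of linear combinations of the
new generators and of old elements. -/
theorem exists_combination_of_mem
    (hS : ∀ {B : CDGA R δ} (f : B ⟶ A), ∀ n ≤ (k : ℤ), S.cells f n = ∅) {B : CDGA R δ} (f : B ⟶ A)
    (hB : B.IsPosGenerated k) {u : S.attach hδ f} (hu : u ∈ (S.attach hδ f).grading (k + 1)) :
    ∃ c, ∃ b ∈ B.grading (k + 1), u = S.combination hδ f (k + 1) c + (S.incl hδ f).toAlgHom b := by
  have h := mem_span_generators_of_mem (S.posGenerators_pos hδ hS f)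
    (S.adjoin_posGenerators hδ f hB) le_rfl (by omega) hu
  clear hu
  induction h using Submodule.span_induction with
  | mem u hu =>
    obtain ⟨⟨b, -, rfl⟩ | ⟨⟨m, s⟩, rfl⟩, hu⟩ := hu
    · exact ⟨0, B.proj (k + 1) b, B.proj_mem _ b, by
        rw [hom_proj, proj_same hu, map_zero, zero_add]⟩
    · by_cases hm : m = k + 1
      · subst hm
        exact ⟨Finsupp.single s 1, 0, Submodule.zero_mem _, by
          rw [combination, Finsupp.linearCombination_single, one_smul, map_zero, add_zero]⟩
      · refine ⟨0, 0, Submodule.zero_mem _, ?_⟩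
        rw [map_zero, map_zero, add_zero, ← proj_same hu, proj_ne (S.cell_mem hδ f ⟨m, s⟩) hm]
  | zero => exact ⟨0, 0, Submodule.zero_mem _, by simp⟩
  | add u v _ _ hu hv =>
    obtain ⟨c, b, hb, rfl⟩ := hu
    obtain ⟨c', b', hb', rfl⟩ := hv
    exact ⟨c + c', b + b', Submodule.add_mem _ hb hb', by simp only [map_add]; abel⟩
  | smul r u _ hu =>
    obtain ⟨c, b, hb, rfl⟩ := hu
    exact ⟨r • c, r • b, Submodule.smul_mem _ r hb, by simp only [map_smul, smul_add]⟩

/-- The homology in degree `k + 1` of each stage injects into that of the target; by degree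
reasons this says that there are no cycles of degree `k + 1` with null-homologous image. -/
theorem eq_zero_of_stage
    (hS : ∀ {B : CDGA R δ} (f : B ⟶ A), ∀ n ≤ (k : ℤ), S.cells f n = ∅)
    (hind : S.IsIndependent (k + 1)) (j : ℕ) :
    ∀ u ∈ ((S.stages hδ (unit A)).obj j).grading (k + 1), ((S.stages hδ (unit A)).obj j).d u = 0 →
      ∀ a ∈ A.grading (k + 1 - δ), (S.stageMap hδ (unit A) j).toAlgHom u = A.d a → u = 0 := by
  induction j with
  | zero =>
    intro u hu _ _ _ _
    have hu : u ∈ (if (k : ℤ) + 1 = 0 then ⊤ else ⊥ : Submodule R R) := hu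
    rwa [if_neg (by omega)] at hu
  | succ j ih =>
    set f := S.stageMap hδ (unit A) j with hf
    suffices h : ∀ u ∈ (S.attach hδ f).grading (k + 1), (S.attach hδ f).d u = 0 →
        ∀ a ∈ A.grading (k + 1 - δ), (S.desc hδ f).toAlgHom u = A.d a → u = 0 from h
    intro u hu hdu a ha hfu
    obtain ⟨c, b, hb, rfl⟩ := S.exists_combination_of_mem hδ hS f
      (S.isPosGenerated_stage hδ hS (unit A) (isPosGenerated_base k) j) hu
    rw [map_add, d_combination, ← Hom.map_d, ← map_add] at hdu
    rw [map_add, desc_combination, desc_incl] at hfu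
    have hdu := S.incl_injective hδ f (hdu.trans (map_zero (S.incl hδ f).toAlgHom).symm)
    have hdu := eq_neg_of_add_eq_zero_left hdu
    -- the new part of `u` exhibits a combination of the attached cells as a trivial cell
    have hc : c = 0 := by
      refine hind f c ⟨-b, Submodule.neg_mem _ hb, a, ha, Prod.ext ?_ ?_⟩
      · rw [map_neg]; exact hdu
      · change _ = f.toAlgHom (-b) + A.d a
        rw [map_neg, eq_neg_add_iff_add_eq, add_comm]
        exact hfu
    subst hc
    rw [map_zero] at hdu hfu
    have hb₀ : b = 0 := ih b hb (neg_eq_zero.1 hdu.symm) a ha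
      (by rw [← hfu]; exact (zero_add _).symm)
    rw [hb₀, map_zero, map_zero, add_zero]

theorem eq_zero_of_model
    (hS : ∀ {B : CDGA R δ} (f : B ⟶ A), ∀ n ≤ (k : ℤ), S.cells f n = ∅)
    (hind : S.IsIndependent (k + 1)) {u : S.model hδ (unit A)}
    (hu : u ∈ (S.model hδ (unit A)).grading (k + 1)) (hdu : (S.model hδ (unit A)).d u = 0) {a : A}
    (ha : a ∈ A.grading (k + 1 - δ)) (hfu : (S.modelMap hδ (unit A)).toAlgHom u = A.d a) :
    u = 0 := by
  obtain ⟨j, b, hb, hdb, rfl⟩ := S.exists_ι_cycle hδ (unit A) hu hdu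
  rw [S.eq_zero_of_stage hδ hS hind j b hb hdb a ha hfu, map_zero]

/-- The model of an algebra with trivial homology up to degree `k` is a quasi-isomorphism if the
chosen cells are those of degree larger than `k` and generate the relative homology there. With
differentials of degree `+1` they have to be independent in degree `k + 1`, as there are no cells of
degree `k` to kill superfluous classes. -/
theorem isQuasiIso_modelMap (hδ' : δ = -1 ∨ δ = 1)
    (hS : ∀ {B : CDGA R δ} (f : B ⟶ A), ∀ n ≤ (k : ℤ), S.cells f n = ∅)
    (hgen : ∀ {B : CDGA R δ} (f : B ⟶ A), ∀ n > (k : ℤ),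
      cellSubmodule f n ≤ Submodule.span R (S.cells f n) ⊔ trivialCells f n)
    (hind : δ = 1 → S.IsIndependent (k + 1)) (hA : A.IsHomologyTrivialTo k) :
    IsQuasiIso (S.modelMap hδ (unit A)) := by
  have hpos : (S.model hδ (unit A)).IsPosGenerated k :=
    S.isPosGenerated_model hδ hS (unit A) (isPosGenerated_base k)
  refine ⟨(homologyMap_injective_iff _).2 ?_, (homologyMap_surjective_iff _).2 ?_⟩
  · intro n z hz hdz a ha hfz
    by_cases hn : n ≤ (k : ℤ)
    · refine ⟨0, Submodule.zero_mem _, ?_⟩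
      rw [map_zero, eq_comm]
      by_cases hn₀ : n + δ = 0
      · rw [hn₀] at hz
        obtain ⟨r, rfl⟩ := hpos.exists_algebraMap hz
        rw [AlgHom.commutes] at hfz
        rw [hA.inj r a hfz.symm, map_zero]
      · by_cases hnk : n + δ ≤ k
        · exact hpos.eq_zero_of_mem hnk hn₀ hz
        -- the one remaining degree, where no cells are available to bound `z`
        · have hδ₁ : δ = 1 := by omega
          have hn' : n = k := by omega
          refine S.eq_zero_of_model hδ hS (hind hδ₁) (u := z) (a := a) ?_ hdz ?_ hfz
          · rwa [show n + δ = k + 1 by omega] at hz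
          · rwa [show (k : ℤ) + 1 - δ = n by omega]
    · obtain ⟨u, hu, hdu, -⟩ := S.fillsCells_modelMap hδ (unit A) (n := n)
        (fun f => hgen f n (not_le.1 hn)) z hz hdz a ha hfz
      exact ⟨u, hu, hdu⟩
  · intro n a ha hda
    by_cases hn : n ≤ (k : ℤ)
    · by_cases hn₀ : n = 0
      · subst hn₀
        obtain ⟨r, b, hb, hdb⟩ := hA.surj a ha hda
        refine ⟨algebraMap R _ r, algebraMap_mem r, d_algebraMap r, -b, Submodule.neg_mem _ hb, ?_⟩
        rw [AlgHom.commutes, map_neg, hdb]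
        abel
      · obtain ⟨b, hb, hdb⟩ := hA.exact n hn hn₀ a ha hda
        refine ⟨0, Submodule.zero_mem _, map_zero _, -b, Submodule.neg_mem _ hb, ?_⟩
        rw [map_zero, map_neg, hdb, add_neg_cancel]
    · exact S.fillsCells_modelMap hδ (unit A) (n := n) (fun f => hgen f n (not_le.1 hn)) 0
        (Submodule.zero_mem _) (map_zero _) a ha (by rw [map_zero, hda])

end CellSystem

/-- Over a field, a submodule has a linearly independent set of representatives of a basis modulo a
smaller submodule. -/
theorem exists_independent_generators (hR : IsField R) {M : Type*} [AddCommGroup M] [Module R M]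
    {p q : Submodule R M} (hqp : q ≤ p) : ∃ s : Set M, s ⊆ p ∧ p ≤ Submodule.span R s ⊔ q ∧
      ∀ c : s →₀ R, Finsupp.linearCombination R Subtype.val c ∈ q → c = 0 := by
  let := hR.toField
  -- a basis of `p ⊓ w`, where `w` is a complement of `q`
  obtain ⟨w, hw⟩ := Submodule.exists_isCompl q
  obtain ⟨s, hs, hspan, hli⟩ := exists_linearIndependent R ((p ⊓ w : Submodule R M) : Set M)
  rw [Submodule.span_eq] at hspan
  refine ⟨s, fun x hx => (hs hx).1, ?_, fun c hc => ?_⟩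
  · rw [hspan]
    intro x hx
    obtain ⟨y, hy, z, hz, rfl⟩ := Submodule.mem_sup.1
      (hw.sup_eq_top ▸ Submodule.mem_top : x ∈ q ⊔ w)
    have hzp : z ∈ p := by simpa using Submodule.sub_mem _ hx (hqp hy)
    exact add_comm y z ▸ Submodule.add_mem_sup (⟨hzp, hz⟩ : z ∈ p ⊓ w) hy
  · refine (linearIndependent_iff.1 hli) c (Submodule.disjoint_def.1 hw.disjoint _ hc ?_)
    have h := (Finsupp.mem_span_iff_linearCombination R s _).2 ⟨c, rfl⟩
    rw [hspan] at h
    exact h.2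

/-- The cells of degree larger than `k` can be chosen as `CellSystem.isQuasiIso_modelMap` demands:
all of them with differentials of degree `-1`, and a basis of the relative homology over a field. -/
theorem exists_cellSystem (hδ : δ = -1 ∨ (δ = 1 ∧ IsField R)) (k : ℕ) (A : CDGA R δ) :
    ∃ S : CellSystem A, (∀ {B : CDGA R δ} (f : B ⟶ A), ∀ n ≤ (k : ℤ), S.cells f n = ∅) ∧
      (∀ {B : CDGA R δ} (f : B ⟶ A), ∀ n > (k : ℤ),
        cellSubmodule f n ≤ Submodule.span R (S.cells f n) ⊔ trivialCells f n) ∧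
      (δ = 1 → S.IsIndependent (k + 1)) := by
  have h : ∀ {B : CDGA R δ} (f : B ⟶ A) (n : ℤ), ∃ s : Set (B × A), s ⊆ cellSubmodule f n ∧
      (n ≤ (k : ℤ) → s = ∅) ∧
      (n > (k : ℤ) → cellSubmodule f n ≤ Submodule.span R s ⊔ trivialCells f n) ∧
      (n > (k : ℤ) → δ = 1 → ∀ c : s →₀ R,
        Finsupp.linearCombination R Subtype.val c ∈ trivialCells f n → c = 0) := by
    intro B f n
    by_cases hn : n ≤ (k : ℤ)
    · exact ⟨∅, Set.empty_subset _, fun _ => rfl, fun h => absurd hn (not_le.2 h),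
        fun h => absurd hn (not_le.2 h)⟩
    · rcases hδ with hδ | ⟨-, hR⟩
      · exact ⟨cellSubmodule f n, le_rfl, fun h => absurd h hn,
          fun _ _ hp => Submodule.mem_sup_left (Submodule.subset_span hp), fun _ h => by omega⟩
      · obtain ⟨s, hs, hspan, hli⟩ := exists_independent_generators hR (trivialCells_le f n)
        exact ⟨s, hs, fun h => absurd h hn, fun _ => hspan, fun _ _ => hli⟩
  choose cells h₁ h₂ h₃ h₄ using @h
  exact ⟨⟨cells, h₁⟩, fun f n => h₂ f n, fun f n => h₃ f n, fun hδ _ f =>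
    h₄ f _ (by omega) hδ⟩

end CDGA

namespace CDGA

variable {R : Type u} [CommRing R] {δ : ℤ}

/-! ### The models are Sullivan algebras -/

theorem FreeGC.gen_mul_gen {X : Type u} (deg : X → ℤ) (x y : X) :
    FreeGC.gen R deg x * FreeGC.gen R deg y =
      (deg x * deg y).negOnePow • (FreeGC.gen R deg y * FreeGC.gen R deg x) := by
  have h := RingQuot.mkAlgHom_rel R (FreeGCRel.swap (R := R) (deg := deg) x y)
  rwa [map_mul, map_negOnePow_smul, map_mul] at h

/-- The universal property of `SV`. -/
def FreeGC.lift {X : Type u} (deg : X → ℤ) {C : Type*} [Ring C] [Algebra R C] (c : X → C)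
    (hc : ∀ x y, c x * c y = (deg x * deg y).negOnePow • (c y * c x)) : FreeGC R deg →ₐ[R] C :=
  RingQuot.liftAlgHom R ⟨FreeAlgebra.lift R c, by
    rintro _ _ ⟨x, y⟩
    simpa [map_negOnePow_smul] using hc x y⟩

@[simp]
theorem FreeGC.lift_gen {X : Type u} (deg : X → ℤ) {C : Type*} [Ring C] [Algebra R C] (c : X → C)
    (hc : ∀ x y, c x * c y = (deg x * deg y).negOnePow • (c y * c x)) (x : X) :
    FreeGC.lift deg c hc (FreeGC.gen R deg x) = c x := by
  simp [FreeGC.lift, FreeGC.gen, RingQuot.liftAlgHom_mkAlgHom_apply]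

theorem FreeGC.algHom_ext {X : Type u} {deg : X → ℤ} {C : Type*} [Ring C] [Algebra R C]
    {f g : FreeGC R deg →ₐ[R] C} (h : ∀ x, f (FreeGC.gen R deg x) = g (FreeGC.gen R deg x)) :
    f = g :=
  RingQuot.ringQuot_ext' R _ _ (FreeAlgebra.hom_ext (funext h))

/-- The free graded-commutative algebra on `X` as a cdg-algebra with zero differential. -/
noncomputable abbrev freeCDGA (hδ : Odd δ) {X : Type u} (deg : X → ℤ) : CDGA R δ :=
  adjoinCells hδ (base R δ) deg 0 (fun _ => Submodule.zero_mem _) (fun _ => map_zero _)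

/-- The generators of the free graded-commutative algebra. -/
noncomputable def freeGen (hδ : Odd δ) {X : Type u} (deg : X → ℤ) (x : X) :
    (freeCDGA hδ deg : CDGA R δ) :=
  adjoinCells.cell _ _ _ _ _ _ x

theorem freeGen_mem (hδ : Odd δ) {X : Type u} (deg : X → ℤ) (x : X) :
    freeGen hδ deg x ∈ (freeCDGA hδ deg : CDGA R δ).grading (deg x) :=
  adjoinCells.cell_mem _ _ _ _ _ _ x

variable (δ) in
/-- The structure map of an algebra, as a map out of the underlying algebra of `base R δ`. -/
def ofBase (C : Type*) [Ring C] [Algebra R C] : base R δ →ₐ[R] C := Algebra.ofId R C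

theorem ofBase_graded_comm {C : Type*} [Ring C] [Algebra R C] (m : ℤ) (c : C) :
    ∀ n, ∀ a ∈ (base R δ).grading n,
      ofBase δ C a * c = (n * m).negOnePow • (c * ofBase δ C a) := by
  intro n a ha
  by_cases hn : n = 0
  · subst hn
    rw [zero_mul, Int.negOnePow_zero, one_smul]
    exact Algebra.commutes (R := R) a c
  · have key : ∀ a : R, a ∈ (if n = 0 then ⊤ else ⊥ : Submodule R R) → a = 0 := by simp [hn]
    have h0 : ofBase δ C a = 0 := (congrArg (algebraMap R C) (key a ha)).trans (map_zero _)
    rw [h0, zero_mul, mul_zero, smul_zero]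

/-- The comparison of the two descriptions of the free graded-commutative algebra. -/
noncomputable def freeCDGAToFreeGC (hδ : Odd δ) {X : Type u} (deg : X → ℤ) :
    (freeCDGA hδ deg : CDGA R δ) →ₐ[R] FreeGC R deg :=
  adjoinCells.lift hδ _ _ _ (ofBase δ (FreeGC R deg)) (FreeGC.gen R deg)
    (fun n a ha x => ofBase_graded_comm (deg x) (FreeGC.gen R deg x) n a ha)
    (FreeGC.gen_mul_gen deg)

theorem freeCDGAToFreeGC_freeGen (hδ : Odd δ) {X : Type u} (deg : X → ℤ) (x : X) :
    freeCDGAToFreeGC (R := R) hδ deg (freeGen hδ deg x) = FreeGC.gen R deg x :=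
  adjoinCells.lift_cell _ _ _ _ x

namespace CellSystem

variable {A : CDGA R δ} (S : CellSystem A) (hδ : Odd δ)

/-- The cells of all stages of the model of `A`. -/
abbrev AllIndex : Type u := Σ j : ℕ, S.Index (S.stageMap hδ (unit A) j)

/-- The degree of a cell. -/
abbrev allDeg (x : S.AllIndex hδ) : ℤ := x.2.1

/-- The generators of the model. -/
noncomputable def modelGen (x : S.AllIndex hδ) : S.model hδ (unit A) :=
  (S.ιSucc hδ (unit A) x.1).toAlgHom (S.cell hδ _ x.2)

theorem modelGen_mem (x : S.AllIndex hδ) :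
    S.modelGen hδ x ∈ (S.model hδ (unit A)).grading (S.allDeg hδ x) :=
  Hom.map_mem _ (S.cell_mem hδ _ x.2)

/-- Stage `j` of the model is generated by the cells that were attached before. -/
theorem ι_mem_adjoin (j : ℕ) (a : (S.stages hδ (unit A)).obj j) :
    (S.ι hδ (unit A) j).toAlgHom a ∈ Algebra.adjoin R (S.modelGen hδ '' {x | x.1 < j}) := by
  induction j with
  | zero =>
    have h : (S.ι hδ (unit A) 0).toAlgHom a = algebraMap R (S.model hδ (unit A)) a :=
      (S.ι hδ (unit A) 0).toAlgHom.commutes a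
    rw [h]
    exact Subalgebra.algebraMap_mem _ _
  | succ j ih =>
    suffices h : (⊤ : Subalgebra R (S.attach hδ (S.stageMap hδ (unit A) j))) ≤
        (Algebra.adjoin R (S.modelGen hδ '' {x | x.1 < j + 1})).comap
          (S.ιSucc hδ (unit A) j).toAlgHom from h (Algebra.mem_top (x := a))
    rw [← S.adjoin_eq_top, Algebra.adjoin_le_iff]
    rintro _ (⟨b, rfl⟩ | ⟨x, rfl⟩)
    · have hsub : {x : S.AllIndex hδ | x.1 < j} ⊆ {x | x.1 < j + 1} :=
        fun _ hx => Nat.lt_succ_of_lt hx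
      have h := Algebra.adjoin_mono (Set.image_mono hsub) (ih b)
      rw [← ιSucc_incl] at h
      exact h
    · exact Algebra.subset_adjoin ⟨⟨j, x⟩, Nat.lt_succ_self j, rfl⟩

theorem adjoin_modelGen : Algebra.adjoin R (Set.range (S.modelGen hδ)) = ⊤ := by
  rw [Algebra.eq_top_iff]
  intro a
  obtain ⟨j, a, rfl⟩ := S.exists_ι hδ (unit A) a
  exact Algebra.adjoin_mono (Set.image_subset_range _ _) (S.ι_mem_adjoin hδ j a)

/-- The map from the free graded-commutative algebra on all cells to the model. -/
noncomputable def fromFreeGC : FreeGC R (S.allDeg hδ) →ₐ[R] S.model hδ (unit A) :=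
  FreeGC.lift _ (S.modelGen hδ) fun x y =>
    (S.model hδ (unit A)).graded_comm (S.modelGen_mem hδ x) (S.modelGen_mem hδ y)

/-- The graded algebra maps from the stages to the free graded-commutative algebra on all cells that
send each cell to the corresponding generator. -/
noncomputable def stageToFree : ∀ j : ℕ,
    {g : (S.stages hδ (unit A)).obj j →ₐ[R] (freeCDGA hδ (S.allDeg hδ) : CDGA R δ) //
      ∀ n, ∀ a ∈ ((S.stages hδ (unit A)).obj j).grading n,
        g a ∈ (freeCDGA hδ (S.allDeg hδ) : CDGA R δ).grading n}
  | 0 => ⟨(unit (freeCDGA hδ (S.allDeg hδ))).toAlgHom, fun _ _ ha => (unit _).map_mem ha⟩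
  | j + 1 => ⟨S.attachLift hδ (S.stageMap hδ (unit A) j) (stageToFree j).1 (stageToFree j).2
      (fun x => freeGen hδ (S.allDeg hδ) ⟨j, x⟩) (fun x => freeGen_mem hδ (S.allDeg hδ) ⟨j, x⟩),
      fun _ _ ha => S.attachLift_mem hδ _ _ _ _ _ ha⟩

theorem stageToFree_succ (j : ℕ) : (S.stageToFree hδ (j + 1)).1 =
    S.attachLift hδ (S.stageMap hδ (unit A) j) (S.stageToFree hδ j).1 (S.stageToFree hδ j).2
      (fun x => freeGen hδ (S.allDeg hδ) ⟨j, x⟩) (fun x => freeGen_mem hδ (S.allDeg hδ) ⟨j, x⟩) :=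
  rfl

/-- The map from the model to the free graded-commutative algebra on all cells. -/
noncomputable def toFree : S.model hδ (unit A) →ₐ[R] (freeCDGA hδ (S.allDeg hδ) : CDGA R δ) :=
  S.modelLift hδ (unit A) (fun j => (S.stageToFree hδ j).1) fun j a => by
    rw [stages_map_succ, stageToFree_succ]
    exact S.attachLift_incl hδ (S.stageMap hδ (unit A) j) _ _ _ _ a

theorem toFree_modelGen (x : S.AllIndex hδ) :
    S.toFree hδ (S.modelGen hδ x) = freeGen hδ (S.allDeg hδ) x :=
  S.attachLift_cell hδ (S.stageMap hδ (unit A) x.1) (S.stageToFree hδ x.1).1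
    (S.stageToFree hδ x.1).2 (fun y => freeGen hδ (S.allDeg hδ) ⟨x.1, y⟩)
    (fun y => freeGen_mem hδ (S.allDeg hδ) ⟨x.1, y⟩) x.2

theorem fromFreeGC_bijective : Function.Bijective (S.fromFreeGC hδ) := by
  constructor
  · refine Function.LeftInverse.injective
      (g := (freeCDGAToFreeGC hδ (S.allDeg hδ)).comp (S.toFree hδ)) fun a => ?_
    have h : ((freeCDGAToFreeGC hδ (S.allDeg hδ)).comp (S.toFree hδ)).comp (S.fromFreeGC hδ) =
        AlgHom.id R _ := FreeGC.algHom_ext fun x => by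
      rw [AlgHom.comp_apply, AlgHom.comp_apply, fromFreeGC, FreeGC.lift_gen, toFree_modelGen,
        freeCDGAToFreeGC_freeGen, AlgHom.id_apply]
    exact DFunLike.congr_fun h a
  · rw [← AlgHom.range_eq_top, eq_top_iff, ← S.adjoin_modelGen, Algebra.adjoin_le_iff]
    rintro _ ⟨x, rfl⟩
    exact ⟨FreeGC.gen R _ x, FreeGC.lift_gen _ _ _ x⟩

theorem isSullivan_model : (S.model hδ (unit A)).IsSullivan := by
  have hφ (x) : AlgEquiv.ofBijective _ (S.fromFreeGC_bijective hδ) (FreeGC.gen R _ x) =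
      S.modelGen hδ x := FreeGC.lift_gen _ _ _ x
  refine ⟨S.AllIndex hδ, ULift ℕ, inferInstance, inferInstance, S.allDeg hδ, fun x => ⟨x.1⟩,
    AlgEquiv.ofBijective _ (S.fromFreeGC_bijective hδ), fun x => ?_, fun x => ?_⟩
  · rw [hφ]
    exact S.modelGen_mem hδ x
  · simp only [hφ]
    rw [modelGen, ← Hom.map_d, d_cell, ιSucc_incl]
    exact S.ι_mem_adjoin hδ x.1 _

end CellSystem

end CDGA

/-! ### Homotopy colimits -/

namespace CDGA

variable {R : Type u} [CommRing R] {δ : ℤ}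

/-- The homology of a homotopy colimit is the colimit of the homology of the terms of the sequence,
for which reason the homotopy colimit has a Sullivan model generated in degrees larger than `k`. -/
theorem IsHocolim.exists_model (hδ : δ = -1 ∨ (δ = 1 ∧ IsField R)) {k : ℕ} {A : ℕ ⥤ CDGA R δ}
    (hA : ∀ i, (A.obj i).IsHomologyTrivialTo k) {H : CDGA R δ} (hH : IsHocolim A H) :
    ∃ S : CDGA R δ, S.IsSullivan ∧ S.IsPosGenerated k ∧ H.QuasiIsomorphic S := by
  obtain ⟨E, w, -, hw, c, ⟨hc⟩, rfl⟩ := hH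
  have hδ' : δ = -1 ∨ δ = 1 := hδ.imp_right And.left
  have hodd : Odd δ := by rcases hδ' with rfl | rfl <;> decide
  have hE : (seqColimit E).IsHomologyTrivialTo k :=
    isHomologyTrivialTo_seqColimit E fun i => (hA i).of_injective (w.app i) (hw i).1
  obtain ⟨S, hS, hgen, hind⟩ := exists_cellSystem hδ k (seqColimit E)
  refine ⟨S.model hodd (unit (seqColimit E)), S.isSullivan_model hodd,
    S.isPosGenerated_model hodd hS _ (isPosGenerated_base k), ?_⟩
  let e := (seqColimit.isColimit E).coconePointUniqueUpToIso hc
  exact .trans _ _ _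
    (.symm _ _ (.rel _ _ ⟨e.hom, isQuasiIso_of_inverse e.hom e.inv e.hom_inv_id e.inv_hom_id⟩))
    (.symm _ _ (.rel _ _ ⟨_, S.isQuasiIso_modelMap hodd hδ' hS hgen hind hE⟩))

end CDGA

theorem mainTheorem7 (R : Type u) [CommRing R] [Algebra ℚ R] (δ : ℤ)
    (hδ : δ = -1 ∨ (δ = 1 ∧ IsField R)) (k : ℕ) (A : ℕ ⥤ CDGA R δ)
    (hsull : ∀ i, (A.obj i).IsSullivan)
    (haug : ∀ i, Nonempty (A.obj i).Augmentation)
    (hpos : ∀ i, (A.obj i).IsPosGenerated k) :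
    (∃ H, CDGA.IsHocolim A H) ∧
      ∀ H, CDGA.IsHocolim A H →
        ∃ S : CDGA R δ, S.IsSullivan ∧ S.IsPosGenerated k ∧ H.QuasiIsomorphic S :=
  ⟨CDGA.exists_isHocolim (by rcases hδ with rfl | ⟨rfl, -⟩ <;> decide) A, fun _ hH =>
    hH.exists_model hδ fun i => (hpos i).isHomologyTrivialTo (haug i).some⟩
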